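/- **Setting.** Outcomes $x_t$ take values in a measurable space $X$ and designs $\xi_t$ in a measurable space $\Xi$, with $\sigma$-finite reference measures $\mathrm dx$, $\mathrm d\xi$; the parameter $\theta$ takes values in a compact set $D_\theta\subset\mathbb R^d$. Put $z_0=x_0$ and $z_t=(x_t,\xi_{t-1})$, $t\ge 1$. Given are the law $p(\mathrm dz_0)$ of the initial outcome, a prior $p(\mathrm d\theta)$ on $D_\theta$, a transition density $f(x'\mid x,\xi,\theta)$, policy densities $\pi(\xi_t\mid z_{0:t})$ (all measurable), and $\eta>0$. Let $p(z_{t}\mid z_{0:t-1},\theta)=f(x_{t}\mid x_{t-1},\xi_{t-1},\theta)\,\pi(\xi_{t-1}\mid z_{0:t-1})$, let $p(\mathrm d\theta\mid z_{0:t})\propto \prod_{s=1}^t p(z_s\mid z_{0:s-1},\theta)\,p(\mathrm d\theta)$ be the posterior, $p(z_t\mid z_{0:t-1})=\int p(z_t\mid z_{0:t-1},\theta)\,p(\mathrm d\theta\mid z_{0:t-1})$ and $$g_t(z_{0:t})=\exp\Bigl\{-\eta\log\int f(x_t\mid x_{t-1},\xi_{t-1},\theta)\,p(\mathrm d\theta\mid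 z_{0:t-1})\Bigr\}.$$ The non-Markovian Feynman–Kac target is $$\Gamma_t(\mathrm dz_{0:t})=\frac1{Z_t}\,p(\mathrm dz_0)\prod_{s=1}^t p(z_s\mid z_{0:s-1})\,g_s(z_{0:s})\,\mathrm dz_s .$$ **The nested filter.** Let $(\kappa_M)_{M\ge1}$ be Markov kernels on $D_\theta$ (jittering kernels). The target distribution $\Gamma_t^M$ of the Inside–Out nested particle filter with $M$ inner particles is the probability law of $(z_{0:t},\theta_{0:t}^{1:M},B_{1:t}^{1:M})$ defined recursively, up to normalization, by $\Gamma_0^M=p(\mathrm dz_0)\prod_{m=1}^M p(\mathrm d\theta_0^m)$ and by multiplying at each step by $$\Bigl\{\tfrac1M\sum_{m=1}^M p(z_{t+1}\mid z_{0:t},\theta_t^m)\Bigr\}\exp\Bigl\{-\eta\log\Bigl(\tfrac1M\sum_{m=1}^M f(x_{t+1}\mid x_t,\xi_t,\theta_t^m)\Bigr)\Bigr\}\,\mathrm dz_{t+1}\;\prod_{m=1}^M W_{t+1}^{B_{t+1}^m}\,\kappa_M(\mathrm d\theta_{t+1}^m\mid\theta_t^{B_{t+1}^m}),$$ where $B_{t+1}^m\in\{1,\dots,M\}$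 and $W_{t+1}^k=p(z_{t+1}\mid z_{0:t},\theta_t^k)/\sum_j p(z_{t+1}\mid z_{0:t},\theta_t^j)$. Let $\Gamma_t^M(z_{0:t})$ denote its marginal in $z_{0:t}$. **Assumptions.** 1. There is $c_\kappa<\infty$ such that for all $M\ge1$ and all bounded measurable $h:D_\theta\to\mathbb R$, $\ \sup_{\theta'\in D_\theta}\int|h(\theta)-h(\theta')|\,\kappa_M(\mathrm d\theta\mid\theta')\le c_\kappa\|h\|_\infty/\sqrt M$. 2. For all $s\ge1$ and all $z_{0:s}$, the function $\theta\mapsto p(z_s\mid z_{0:s-1},\theta)$ is positive and bounded on $D_\theta$. 3. For all $x,\xi,x'$, the function $\theta\mapsto f(x'\mid x,\xi,\theta)$ is positive and bounded on $D_\theta$. 4. (Integrability, at the time $t$ considered.) $\displaystyle\int p(\mathrm dz_0)\prod_{s=1}^t \pi(\xi_{s-1}\mid z_{0:s-1})\,\sup_{\theta\in D_\theta} f(x_s\mid x_{s-1},\xi_{s-1},\theta)^{1-\eta}\,\mathrm dz_{s}<\infty$ (a lower integral if the integrand is not measurable). **Proposition (Consistency).** Under these assumptions $\Gamma_t$ and,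 for every $M\ge1$, $\Gamma_t^M$ are well-defined probability measures (their normalizing constants are finite and positive), and for every bounded measurable function $h$ of $z_{0:t}$, $$\lim_{M\to\infty}\int h(z_{0:t})\,\Gamma_t^M(\mathrm dz_{0:t})=\int h(z_{0:t})\,\Gamma_t(\mathrm dz_{0:t}).$$ -/

import Mathlib

open MeasureTheory ProbabilityTheory Filter Topology

universe u v

noncomputable section

/-- Trajectories `z_{0:t}`: `z_0 = x_0` is an outcome, and `z_{s+1} = (x_{s+1}, ξ_s)` consists of
the next outcome and of the design that was used to produce it. -/
def Traj (X Ξ : Type u) : ℕ → Type u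
  | 0 => X
  | t + 1 => Traj X Ξ t × (X × Ξ)

instance Traj.instMeasurableSpace (X Ξ : Type u) [MeasurableSpace X] [MeasurableSpace Ξ] :
    ∀ t, MeasurableSpace (Traj X Ξ t)
  | 0 => inferInstanceAs (MeasurableSpace X)
  | t + 1 =>
    letI := Traj.instMeasurableSpace X Ξ t
    inferInstanceAs (MeasurableSpace (Traj X Ξ t × (X × Ξ)))

/-- The current outcome `x_t` of a trajectory `z_{0:t}`. -/
def Traj.outcome {X Ξ : Type u} : ∀ t, Traj X Ξ t → X
  | 0, x => x
  | _ + 1, z => z.2.1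

theorem Traj.measurable_outcome {X Ξ : Type u} [MeasurableSpace X] [MeasurableSpace Ξ] :
    ∀ t, Measurable (Traj.outcome (X := X) (Ξ := Ξ) t)
  | 0 => measurable_id
  | _ + 1 => measurable_fst.comp measurable_snd

/-- A sequential experimental design model.  Outcomes take values in `X`, designs in `Ξ`, with
reference measures `lam` and `rho` (`dx` and `dξ`), and the parameter takes values in `Θ`. -/
structure DesignModel (X Ξ : Type u) (Θ : Type v)
    [MeasurableSpace X] [MeasurableSpace Ξ] [MeasurableSpace Θ]
    (lam : Measure X) (rho : Measure Ξ) where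
  /-- the law `p(z_0)` of the initial outcome -/
  init : Measure X
  init_prob : IsProbabilityMeasure init
  /-- the prior `p(θ)` -/
  prior : Measure Θ
  prior_prob : IsProbabilityMeasure prior
  /-- the transition density: `f x ξ θ x'` is `f(x' ∣ x, ξ, θ)` -/
  f : X → Ξ → Θ → X → ℝ
  f_measurable : Measurable fun q : X × Ξ × Θ × X => f q.1 q.2.1 q.2.2.1 q.2.2.2
  f_nonneg : ∀ x ξ θ x', 0 ≤ f x ξ θ x'
  f_lintegral : ∀ x ξ θ, ∫⁻ x', ENNReal.ofReal (f x ξ θ x') ∂lam = 1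
  /-- the stochastic policy: `policy t z ξ` is `π(ξ ∣ z_{0:t})` -/
  policy : ∀ t, Traj X Ξ t → Ξ → ℝ
  policy_measurable : ∀ t, Measurable fun q : Traj X Ξ t × Ξ => policy t q.1 q.2
  policy_nonneg : ∀ t z ξ, 0 ≤ policy t z ξ
  policy_lintegral : ∀ t z, ∫⁻ ξ, ENNReal.ofReal (policy t z ξ) ∂rho = 1

attribute [instance] DesignModel.init_prob DesignModel.prior_prob

namespace DesignModel

variable {X Ξ : Type u} {Θ : Type v} [MeasurableSpace X] [MeasurableSpace Ξ] [MeasurableSpace Θ]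
  {lam : Measure X} {rho : Measure Ξ}

/-- `f(x_{t+1} ∣ x_t, ξ_t, θ)` as a function of `z_{0:t}`, `z_{t+1} = (x_{t+1}, ξ_t)` and `θ`. -/
def trans (P : DesignModel X Ξ Θ lam rho) (t : ℕ) (z : Traj X Ξ t) (zn : X × Ξ) (θ : Θ) : ℝ :=
  P.f (Traj.outcome t z) zn.2 θ zn.1

/-- `p(z_{t+1} ∣ z_{0:t}, θ) = f(x_{t+1} ∣ x_t, ξ_t, θ) π(ξ_t ∣ z_{0:t})`. -/
def lik (P : DesignModel X Ξ Θ lam rho) (t : ℕ) (z : Traj X Ξ t) (zn : X × Ξ) (θ : Θ) : ℝ :=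
  P.trans t z zn θ * P.policy t z zn.2

/-! ### The exact target `Γ_t` -/

/-- `∏_{s=1}^t p(z_s ∣ z_{0:s-1}, θ)`. -/
def fullLik (P : DesignModel X Ξ Θ lam rho) : ∀ t, Traj X Ξ t → Θ → ℝ
  | 0, _, _ => 1
  | t + 1, z, θ => P.fullLik t z.1 θ * P.lik t z.1 z.2 θ

/-- The posterior `p(dθ ∣ z_{0:t})`, given by Bayes' formula. -/
def posterior (P : DesignModel X Ξ Θ lam rho) (t : ℕ) (z : Traj X Ξ t) : Measure Θ :=
  (∫⁻ θ, ENNReal.ofReal (P.fullLik t z θ) ∂P.prior)⁻¹ •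
    P.prior.withDensity fun θ => ENNReal.ofReal (P.fullLik t z θ)

/-- `p(z_{t+1} ∣ z_{0:t}) = ∫ p(z_{t+1} ∣ z_{0:t}, θ) p(dθ ∣ z_{0:t})`. -/
def marginal (P : DesignModel X Ξ Θ lam rho) (t : ℕ) (z : Traj X Ξ t) (zn : X × Ξ) : ℝ :=
  ∫ θ, P.lik t z zn θ ∂(P.posterior t z)

/-- `r_{t+1}(z_{0:t+1}) = - log ∫ f(x_{t+1} ∣ x_t, ξ_t, θ) p(dθ ∣ z_{0:t})`. -/
def reward (P : DesignModel X Ξ Θ lam rho) (t : ℕ) (z : Traj X Ξ t) (zn : X × Ξ) : ℝ :=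
  -Real.log (∫ θ, P.trans t z zn θ ∂(P.posterior t z))

/-- The potential `g_{t+1}(z_{0:t+1}) = exp (η r_{t+1}(z_{0:t+1}))`. -/
def potential (P : DesignModel X Ξ Θ lam rho) (η : ℝ) (t : ℕ) (z : Traj X Ξ t) (zn : X × Ξ) : ℝ :=
  Real.exp (η * P.reward t z zn)

/-- The reference measure `p(dz_0) dz_1 ⋯ dz_t` on trajectories. -/
def ref (P : DesignModel X Ξ Θ lam rho) : ∀ t, Measure (Traj X Ξ t)
  | 0 => P.init
  | t + 1 => (P.ref t).prod (lam.prod rho)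

/-- `∏_{s=1}^t p(z_s ∣ z_{0:s-1}) g_s(z_{0:s})`. -/
def targetDensity (P : DesignModel X Ξ Θ lam rho) (η : ℝ) : ∀ t, Traj X Ξ t → ℝ
  | 0, _ => 1
  | t + 1, z => P.targetDensity η t z.1 * (P.marginal t z.1 z.2 * P.potential η t z.1 z.2)

/-- The unnormalized measure `p(dz_0) ∏_{s=1}^t p(z_s ∣ z_{0:s-1}) g_s(z_{0:s}) dz_s`. -/
def targetUnnorm (P : DesignModel X Ξ Θ lam rho) (η : ℝ) (t : ℕ) : Measure (Traj X Ξ t) :=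
  (P.ref t).withDensity fun z => ENNReal.ofReal (P.targetDensity η t z)

/-- The non-Markovian Feynman–Kac target `Γ_t`. -/
def target (P : DesignModel X Ξ Θ lam rho) (η : ℝ) (t : ℕ) : Measure (Traj X Ξ t) :=
  (P.targetUnnorm η t Set.univ)⁻¹ • P.targetUnnorm η t

end DesignModel

/-! ### The target `Γ_t^M` of the nested filter -/

/-- The path `(z_{0:t}, θ_{0:t}^{1:M}, B_{1:t}^{1:M})` of one outer particle.  At time `0` it is
`(z_0, θ_0^{1:M})`, and time `t + 1` appends `(z_{t+1}, (B_{t+1}^m, θ_{t+1}^m)_m)`. -/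
def NPath (X Ξ : Type u) (Θ : Type) (M : ℕ) : ℕ → Type u
  | 0 => X × (Fin M → Θ)
  | t + 1 => NPath X Ξ Θ M t × ((X × Ξ) × (Fin M → Fin M × Θ))

namespace NPath

variable {X Ξ : Type u} {Θ : Type} {M : ℕ}

instance instMeasurableSpace (X Ξ : Type u) (Θ : Type) (M : ℕ)
    [MeasurableSpace X] [MeasurableSpace Ξ] [MeasurableSpace Θ] :
    ∀ t, MeasurableSpace (NPath X Ξ Θ M t)
  | 0 => inferInstanceAs (MeasurableSpace (X × (Fin M → Θ)))
  | t + 1 =>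
    letI := instMeasurableSpace X Ξ Θ M t
    inferInstanceAs (MeasurableSpace (NPath X Ξ Θ M t × ((X × Ξ) × (Fin M → Fin M × Θ))))

/-- The trajectory `z_{0:t}` of a path. -/
def traj : ∀ t, NPath X Ξ Θ M t → Traj X Ξ t
  | 0, y => y.1
  | t + 1, y => (traj t y.1, y.2.1)

/-- The current parameter particles `θ_t^{1:M}` of a path. -/
def particles : ∀ t, NPath X Ξ Θ M t → Fin M → Θ
  | 0, y => y.2
  | _ + 1, y => fun m => (y.2.2 m).2

variable [MeasurableSpace X] [MeasurableSpace Ξ] [MeasurableSpace Θ]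

theorem measurable_traj : ∀ t, Measurable (traj (X := X) (Ξ := Ξ) (Θ := Θ) (M := M) t)
  | 0 => measurable_fst
  | t + 1 => ((measurable_traj t).comp measurable_fst).prodMk (measurable_fst.comp measurable_snd)

theorem measurable_particles : ∀ t, Measurable (particles (X := X) (Ξ := Ξ) (Θ := Θ) (M := M) t)
  | 0 => measurable_snd
  | _ + 1 => measurable_pi_lambda _ fun m =>
      measurable_snd.comp ((measurable_pi_apply m).comp (measurable_snd.comp measurable_snd))

end NPath

namespace DesignModel

variable {X Ξ : Type u} {Θ : Type} [MeasurableSpace X] [MeasurableSpace Ξ] [MeasurableSpace Θ]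
  {lam : Measure X} {rho : Measure Ξ}

theorem measurable_trans (P : DesignModel X Ξ Θ lam rho) (t : ℕ) :
    Measurable fun q : Traj X Ξ t × (X × Ξ) × Θ => P.trans t q.1 q.2.1 q.2.2 := by
  have h : Measurable fun q : Traj X Ξ t × (X × Ξ) × Θ =>
      (Traj.outcome t q.1, q.2.1.2, q.2.2, q.2.1.1) := by
    have := Traj.measurable_outcome (X := X) (Ξ := Ξ) t
    fun_prop
  exact P.f_measurable.comp h

theorem measurable_lik (P : DesignModel X Ξ Θ lam rho) (t : ℕ) :
    Measurable fun q : Traj X Ξ t × (X × Ξ) × Θ => P.lik t q.1 q.2.1 q.2.2 := by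
  refine (P.measurable_trans t).mul ?_
  have h : Measurable fun q : Traj X Ξ t × (X × Ξ) × Θ => (q.1, q.2.1.2) := by fun_prop
  exact (P.policy_measurable t).comp h

/-- The average `(1/M) ∑_m φ(θ^m)`. -/
def empMean {M : ℕ} (θs : Fin M → Θ) (φ : Θ → ℝ) : ℝ :=
  (1 / (M : ℝ)) * ∑ m, φ (θs m)

/-- The weight `W_{θ,t+1}^k`, proportional to `p(z_{t+1} ∣ z_{0:t}, θ_t^k)`. -/
def weight (P : DesignModel X Ξ Θ lam rho) {M : ℕ} (t : ℕ) (z : Traj X Ξ t) (zn : X × Ξ)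
    (θs : Fin M → Θ) (k : Fin M) : ℝ :=
  P.lik t z zn (θs k) / ∑ j, P.lik t z zn (θs j)

/-- The law of one pair `(B_{t+1}^m, θ_{t+1}^m)` given `z_{0:t+1}` and `θ_t^{1:M}`: the ancestor
index is drawn from the weights, and the particle from the jittering kernel at the ancestor. -/
def resampleJitter (P : DesignModel X Ξ Θ lam rho) (κ : Kernel Θ Θ) {M : ℕ} (t : ℕ)
    (z : Traj X Ξ t) (zn : X × Ξ) (θs : Fin M → Θ) : Measure (Fin M × Θ) :=
  ∑ k, ENNReal.ofReal (P.weight t z zn θs k) • (Measure.dirac k).prod (κ (θs k))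

instance resampleJitter_finite (P : DesignModel X Ξ Θ lam rho) (κ : Kernel Θ Θ) [IsMarkovKernel κ]
    {M : ℕ} (t : ℕ) (z : Traj X Ξ t) (zn : X × Ξ) (θs : Fin M → Θ) :
    IsFiniteMeasure (P.resampleJitter κ t z zn θs) := by
  refine ⟨?_⟩
  rw [resampleJitter, Measure.finsetSum_apply]
  refine ENNReal.sum_lt_top.2 fun k _ => ?_
  rw [Measure.smul_apply, smul_eq_mul]
  exact ENNReal.mul_lt_top ENNReal.ofReal_lt_top (measure_lt_top _ _)

theorem measurable_resampleJitter (P : DesignModel X Ξ Θ lam rho) (κ : Kernel Θ Θ)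
    [IsMarkovKernel κ] {M : ℕ} (t : ℕ) {s : Set (Fin M × Θ)} (hs : MeasurableSet s) :
    Measurable fun q : NPath X Ξ Θ M t × (X × Ξ) =>
      P.resampleJitter κ t (NPath.traj t q.1) q.2 (NPath.particles t q.1) s := by
  simp only [resampleJitter, Measure.finsetSum_apply, Measure.smul_apply, smul_eq_mul]
  have hθ : ∀ k : Fin M, Measurable fun q : NPath X Ξ Θ M t × (X × Ξ) =>
      NPath.particles t q.1 k := fun k =>
    (measurable_pi_apply k).comp ((NPath.measurable_particles t).comp measurable_fst)
  have hl : ∀ k : Fin M, Measurable fun q : NPath X Ξ Θ M t × (X × Ξ) =>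
      P.lik t (NPath.traj t q.1) q.2 (NPath.particles t q.1 k) := fun k =>
    (P.measurable_lik t).comp
      (((NPath.measurable_traj t).comp measurable_fst).prodMk (measurable_snd.prodMk (hθ k)))
  refine Finset.measurable_sum _ fun k _ => Measurable.mul ?_ ?_
  · exact ((hl k).div (Finset.measurable_sum _ fun j _ => hl j)).ennreal_ofReal
  · have hk : ∀ q : NPath X Ξ Θ M t × (X × Ξ),
        ((Measure.dirac k).prod (κ (NPath.particles t q.1 k))) s
          = κ (NPath.particles t q.1 k) (Prod.mk k ⁻¹' s) := by
      intro q
      rw [Measure.dirac_prod, Measure.map_apply measurable_prodMk_left hs]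
    simp only [hk]
    exact (κ.measurable_coe (measurable_prodMk_left hs)).comp (hθ k)

/-- The resample and jitter steps: the pairs `(B_{t+1}^m, θ_{t+1}^m)`, `m = 1, …, M`, are drawn
independently given `z_{0:t+1}` and `θ_t^{1:M}`, with density
`∏_m W_{θ,t+1}^{B_{t+1}^m} κ(θ_{t+1}^m ∣ θ_t^{B_{t+1}^m})`. -/
def innerKernel (P : DesignModel X Ξ Θ lam rho) (κ : Kernel Θ Θ) [IsMarkovKernel κ] (M t : ℕ) :
    Kernel (NPath X Ξ Θ M t × (X × Ξ)) (Fin M → Fin M × Θ) where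
  toFun q := Measure.pi fun _ =>
    P.resampleJitter κ t (NPath.traj t q.1) q.2 (NPath.particles t q.1)
  measurable' := by
    refine Measurable.measure_of_isPiSystem generateFrom_pi.symm isPiSystem_pi ?_ ?_
    · rintro _ ⟨s, hs, rfl⟩
      simp only [Measure.pi_pi]
      exact Finset.measurable_prod _ fun m _ =>
        P.measurable_resampleJitter κ t (hs m (Set.mem_univ m))
    · simp only [Measure.pi_univ]
      exact Finset.measurable_prod _ fun m _ =>
        P.measurable_resampleJitter κ t MeasurableSet.univ

/-- The propagate and reweight factor
`{(1/M) ∑_m p(z_{t+1} ∣ z_{0:t}, θ_t^m)} exp {- η log ((1/M) ∑_m f(x_{t+1} ∣ x_t, ξ_t, θ_t^m))}`. -/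
def outerDensity (P : DesignModel X Ξ Θ lam rho) (η : ℝ) {M : ℕ} (t : ℕ)
    (y : NPath X Ξ Θ M t) (zn : X × Ξ) : ℝ :=
  empMean (NPath.particles t y) (P.lik t (NPath.traj t y) zn) *
    Real.exp (-η * Real.log (empMean (NPath.particles t y) (P.trans t (NPath.traj t y) zn)))

theorem measurable_outerDensity (P : DesignModel X Ξ Θ lam rho) (η : ℝ) (M t : ℕ) :
    Measurable fun q : NPath X Ξ Θ M t × (X × Ξ) => P.outerDensity η t q.1 q.2 := by
  have ha : ∀ k : Fin M, Measurable fun q : NPath X Ξ Θ M t × (X × Ξ) =>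
      (NPath.traj t q.1, q.2, NPath.particles t q.1 k) := fun k =>
    ((NPath.measurable_traj t).comp measurable_fst).prodMk (measurable_snd.prodMk
      ((measurable_pi_apply k).comp ((NPath.measurable_particles t).comp measurable_fst)))
  refine Measurable.mul ?_ (Real.measurable_exp.comp
    ((Real.measurable_log.comp ?_).const_mul (-η)))
  · exact (Finset.measurable_sum _ fun k _ => (P.measurable_lik t).comp (ha k)).const_mul _
  · exact (Finset.measurable_sum _ fun k _ => (P.measurable_trans t).comp (ha k)).const_mul _

/-- The unnormalized kernel that draws `z_{t+1}` with density `outerDensity` against `dx dξ`. -/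
def outerKernel (P : DesignModel X Ξ Θ lam rho) [SigmaFinite lam] [SigmaFinite rho]
    (η : ℝ) (M t : ℕ) : Kernel (NPath X Ξ Θ M t) (X × Ξ) :=
  (Kernel.const _ (lam.prod rho)).withDensity fun y zn => ENNReal.ofReal (P.outerDensity η t y zn)

instance outerKernel_sfinite (P : DesignModel X Ξ Θ lam rho) [SigmaFinite lam] [SigmaFinite rho]
    (η : ℝ) (M t : ℕ) : IsSFiniteKernel (P.outerKernel η M t) :=
  Kernel.IsSFiniteKernel.withDensity _ fun _ _ => ENNReal.ofReal_ne_top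

theorem lik_nonneg (P : DesignModel X Ξ Θ lam rho) (t : ℕ) (z : Traj X Ξ t) (zn : X × Ξ) (θ : Θ) :
    0 ≤ P.lik t z zn θ :=
  mul_nonneg (P.f_nonneg _ _ _ _) (P.policy_nonneg _ _ _)

theorem resampleJitter_univ_le (P : DesignModel X Ξ Θ lam rho) (κ : Kernel Θ Θ) [IsMarkovKernel κ]
    {M : ℕ} (t : ℕ) (z : Traj X Ξ t) (zn : X × Ξ) (θs : Fin M → Θ) :
    P.resampleJitter κ t z zn θs Set.univ ≤ 1 := by
  have h0 : ∀ k ∈ Finset.univ, 0 ≤ P.weight t z zn θs k := fun k _ =>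
    div_nonneg (P.lik_nonneg _ _ _ _) (Finset.sum_nonneg fun j _ => P.lik_nonneg _ _ _ _)
  simp only [resampleJitter, Measure.finsetSum_apply, Measure.smul_apply, smul_eq_mul,
    measure_univ, mul_one]
  rw [← ENNReal.ofReal_sum_of_nonneg h0, ENNReal.ofReal_le_one]
  simp only [weight]
  rw [← Finset.sum_div]
  exact div_self_le_one _

instance innerKernel_finite (P : DesignModel X Ξ Θ lam rho) (κ : Kernel Θ Θ) [IsMarkovKernel κ]
    (M t : ℕ) : IsFiniteKernel (P.innerKernel κ M t) := by
  refine ⟨1, ENNReal.one_lt_top, fun q => ?_⟩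
  change Measure.pi (fun _ : Fin M =>
    P.resampleJitter κ t (NPath.traj t q.1) q.2 (NPath.particles t q.1)) Set.univ ≤ 1
  rw [Measure.pi_univ]
  exact Finset.prod_le_one' fun m _ => P.resampleJitter_univ_le κ t _ _ _

/-- The unnormalized target of the nested filter on paths `(z_{0:t}, θ_{0:t}^{1:M}, B_{1:t}^{1:M})`.
-/
def nestedUnnorm (P : DesignModel X Ξ Θ lam rho) [SigmaFinite lam] [SigmaFinite rho]
    (κ : Kernel Θ Θ) [IsMarkovKernel κ] (η : ℝ) (M : ℕ) : ∀ t, Measure (NPath X Ξ Θ M t)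
  | 0 => P.init.prod (Measure.pi fun _ : Fin M => P.prior)
  | t + 1 => (P.nestedUnnorm κ η M t) ⊗ₘ (P.outerKernel η M t ⊗ₖ P.innerKernel κ M t)

instance nestedUnnorm_sfinite (P : DesignModel X Ξ Θ lam rho) [SigmaFinite lam] [SigmaFinite rho]
    (κ : Kernel Θ Θ) [IsMarkovKernel κ] (η : ℝ) (M : ℕ) :
    ∀ t, SFinite (P.nestedUnnorm κ η M t)
  | 0 => inferInstanceAs (SFinite (P.init.prod (Measure.pi fun _ : Fin M => P.prior)))
  | t + 1 =>
    haveI := nestedUnnorm_sfinite P κ η M t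
    inferInstanceAs (SFinite
      ((P.nestedUnnorm κ η M t) ⊗ₘ (P.outerKernel η M t ⊗ₖ P.innerKernel κ M t)))

/-- The target distribution of the nested filter on paths. -/
def nestedTarget (P : DesignModel X Ξ Θ lam rho) [SigmaFinite lam] [SigmaFinite rho]
    (κ : Kernel Θ Θ) [IsMarkovKernel κ] (η : ℝ) (M t : ℕ) : Measure (NPath X Ξ Θ M t) :=
  (P.nestedUnnorm κ η M t Set.univ)⁻¹ • P.nestedUnnorm κ η M t

/-- The marginal target distribution `Γ_t^M` on trajectories `z_{0:t}`. -/
def nestedMarginal (P : DesignModel X Ξ Θ lam rho) [SigmaFinite lam] [SigmaFinite rho]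
    (κ : Kernel Θ Θ) [IsMarkovKernel κ] (η : ℝ) (M t : ℕ) : Measure (Traj X Ξ t) :=
  (P.nestedTarget κ η M t).map (NPath.traj t)

/-- `∏_{s=1}^t π(ξ_{s-1} ∣ z_{0:s-1}) sup_θ f(x_s ∣ x_{s-1}, ξ_{s-1}, θ) ^ (1 - η)`. -/
def envelope (P : DesignModel X Ξ Θ lam rho) (η : ℝ) : ∀ t, Traj X Ξ t → ENNReal
  | 0, _ => 1
  | t + 1, z => P.envelope η t z.1 * (ENNReal.ofReal (P.policy t z.1 z.2.2) *
      ⨆ θ, ENNReal.ofReal (P.trans t z.1 z.2 θ ^ (1 - η)))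

end DesignModel

/-- The jittering kernels perturb bounded functions by `O(M ^ (-1/2))`: for some `c`, every `M ≥ 1`
and every bounded measurable `h`,
`sup_{θ'} ∫ |h(θ) - h(θ')| κ_M(dθ ∣ θ') ≤ c ‖h‖_∞ / √M` (`b` is any bound for `|h|`). -/
def IsJittering {Θ : Type} [MeasurableSpace Θ] (κ : ℕ → Kernel Θ Θ) : Prop :=
  ∃ c : ℝ, ∀ M : ℕ, 1 ≤ M → ∀ (h : Θ → ℝ) (b : ℝ), Measurable h → (∀ θ, |h θ| ≤ b) →
    ∀ θ', ∫ θ, |h θ - h θ'| ∂(κ M θ') ≤ c * b / Real.sqrt M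

end

/-! Given the trajectory, only the current particles matter for the next step, so earlier particles
and ancestor indices can be integrated out. What remains is a disintegration
(`lintegral_nestedUnnorm`): the unnormalized nested target, seen on (trajectory, current particles),
is the reference measure on trajectories times an unnormalized kernel `particleLaw`. The total mass
of this kernel is therefore the density of the trajectory (`map_traj_nestedUnnorm`), and it suffices
that these densities converge pointwise to `targetDensity` under an integrable bound.

Pointwise convergence (`tendsto_particleLaw`) is an induction on `t` along a fixed trajectory,
carrying two claims at once: the mass converges to the target density, and averages of every bounded
function over the particles converge in mean to posterior averages. The second claim is propagated
by `lintegral_abs_sub_particleKernel_le`, which adds up the Monte Carlo error, the jittering error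
and the error of self-normalized weights, the limit being Bayes' update of the posterior. The first
follows from the second, because the reweighting factor is a function of one particle average,
continuous at its positive limit and bounded (`tendsto_lintegral_comp_of_tendsto_mean`).

The bound comes from the fact that a power of an average of positive numbers is at most the same
power of one of them, whatever the sign of the exponent. The supremum over all parameters in
`envelope` need not be measurable, however. It is replaced by an essential supremum with respect to
a measure that dominates the prior and whose null sets the jittering kernels respect
(`exists_sFinite_absolutelyContinuous_bind`); almost surely no particle ever exceeds it. Dominated
convergence for numerator and normalizing constant concludes. -/

noncomputable section

namespace DesignModel

/-! ### Averages over finitely many particles -/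

section EmpiricalMean

variable {Θ : Type}

theorem empMean_pos {M : ℕ} (hM : 1 ≤ M) {h : Θ → ℝ} (hh : ∀ θ, 0 < h θ) (θs : Fin M → Θ) :
    0 < empMean θs h := by
  have : NeZero M := ⟨by omega⟩
  have hM' : (0 : ℝ) < M := by exact_mod_cast hM
  exact mul_pos (by positivity) (Finset.sum_pos (fun m _ => hh _) Finset.univ_nonempty)

theorem empMean_mul_const {M : ℕ} (θs : Fin M → Θ) (h : Θ → ℝ) (c : ℝ) :
    empMean θs (fun θ => h θ * c) = empMean θs h * c := by
  simp only [empMean, ← Finset.sum_mul, mul_assoc]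

/-- Not all values can exceed their average. Together with the opposite bound, this transfers
estimates valid at each particle to the average; the sign of an exponent decides which of the two is
needed. -/
theorem exists_le_empMean {M : ℕ} (hM : 1 ≤ M) (h : Θ → ℝ) (θs : Fin M → Θ) :
    ∃ m, h (θs m) ≤ empMean θs h := by
  have : NeZero M := ⟨by omega⟩
  have hM' : (0 : ℝ) < M := by exact_mod_cast hM
  obtain ⟨m, -, hm⟩ := Finset.exists_le_of_sum_le (s := Finset.univ) (f := fun m => h (θs m))
    (g := fun _ : Fin M => empMean θs h) Finset.univ_nonempty (by
      simp only [empMean, Finset.sum_const, Finset.card_univ, Fintype.card_fin, nsmul_eq_mul]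
      field_simp; rfl)
  exact ⟨m, hm⟩

theorem exists_empMean_le {M : ℕ} (hM : 1 ≤ M) (h : Θ → ℝ) (θs : Fin M → Θ) :
    ∃ m, empMean θs h ≤ h (θs m) := by
  have : NeZero M := ⟨by omega⟩
  have hM' : (0 : ℝ) < M := by exact_mod_cast hM
  obtain ⟨m, -, hm⟩ := Finset.exists_le_of_sum_le (s := Finset.univ) (g := fun m => h (θs m))
    (f := fun _ : Fin M => empMean θs h) Finset.univ_nonempty (by
      simp only [empMean, Finset.sum_const, Finset.card_univ, Fintype.card_fin, nsmul_eq_mul]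
      field_simp; rfl)
  exact ⟨m, hm⟩

/-- A power of an average of positive numbers is at most the largest of the powers. -/
theorem exists_empMean_rpow_le {M : ℕ} (hM : 1 ≤ M) {h : Θ → ℝ} (hh : ∀ θ, 0 < h θ) (p : ℝ)
    (θs : Fin M → Θ) : ∃ m, empMean θs h ^ p ≤ h (θs m) ^ p := by
  rcases le_total 0 p with hp | hp
  · obtain ⟨m, hm⟩ := exists_empMean_le hM h θs
    exact ⟨m, Real.rpow_le_rpow (empMean_pos hM hh θs).le hm hp⟩
  · obtain ⟨m, hm⟩ := exists_le_empMean hM h θs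
    exact ⟨m, Real.rpow_le_rpow_of_nonpos (hh _) hm hp⟩

theorem abs_empMean_le {M : ℕ} (hM : 1 ≤ M) {h : Θ → ℝ} {b : ℝ} (hb : ∀ θ, |h θ| ≤ b)
    (θs : Fin M → Θ) : |empMean θs h| ≤ b := by
  obtain ⟨m, hm⟩ := exists_le_empMean hM h θs
  obtain ⟨k, hk⟩ := exists_empMean_le hM h θs
  exact abs_le.2 ⟨(abs_le.1 (hb _)).1.trans hm, hk.trans (abs_le.1 (hb _)).2⟩

variable [MeasurableSpace Θ]

theorem measurable_empMean {M : ℕ} {h : Θ → ℝ} (hh : Measurable h) :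
    Measurable fun θs : Fin M → Θ => empMean θs h :=
  (Finset.measurable_sum _ fun m _ => hh.comp (measurable_pi_apply m)).const_mul _

/-- The mean error of a Monte Carlo average of `M` independent draws is at most `b / √M`. -/
theorem lintegral_abs_empMean_sub_le (σ : Measure Θ) [IsProbabilityMeasure σ] {M : ℕ} (hM : 1 ≤ M)
    {h : Θ → ℝ} (hh : Measurable h) {b : ℝ} (hb : ∀ θ, |h θ| ≤ b) :
    ∫⁻ θs, ENNReal.ofReal |empMean θs h - ∫ θ, h θ ∂σ| ∂(Measure.pi fun _ : Fin M => σ)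
      ≤ ENNReal.ofReal (b / Real.sqrt M) := by
  have hM' : (0 : ℝ) < M := by exact_mod_cast hM
  set μ := Measure.pi fun _ : Fin M => σ
  set a := ∫ θ, h θ ∂σ
  have hL : MemLp h 2 σ := MemLp.of_bound hh.aestronglyMeasurable b (ae_of_all _ hb)
  have hem : Measurable fun θs : Fin M → Θ => empMean θs h := measurable_empMean hh
  have hLe : MemLp (fun θs : Fin M → Θ => empMean θs h) 2 μ :=
    MemLp.of_bound hem.aestronglyMeasurable b (ae_of_all _ (abs_empMean_le hM hb))
  have hLd : MemLp (fun θs : Fin M → Θ => empMean θs h - a) 2 μ := hLe.sub (memLp_const a)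
  have hLa : MemLp (fun θs : Fin M → Θ => |empMean θs h - a|) 2 μ := hLd.abs
  have hmean : ∫ θs, empMean θs h ∂μ = a := by
    simp only [empMean]
    rw [integral_const_mul, integral_finsetSum]
    · have : ∀ i : Fin M, ∫ θs, h (θs i) ∂μ = a := fun i =>
        integral_comp_eval (μ := fun _ : Fin M => σ) (f := h) hh.aestronglyMeasurable
      simp only [this, Finset.sum_const, Finset.card_univ, Fintype.card_fin, nsmul_eq_mul]
      field_simp
    · intro i _
      exact Integrable.of_bound (hh.comp (measurable_pi_apply i)).aestronglyMeasurable b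
        (ae_of_all _ fun θs => hb _)
  have hvar : Var[fun θs : Fin M → Θ => empMean θs h; μ] ≤ b ^ 2 / M := by
    have h1 : Var[fun θs : Fin M → Θ => ∑ i, h (θs i); μ] = M * Var[h; σ] := by
      have := variance_sum_pi (μ := fun _ : Fin M => σ) (X := fun _ => h) (fun _ => hL)
      simp only [Finset.sum_const, Finset.card_univ, Fintype.card_fin, nsmul_eq_mul] at this
      rw [← this]
      congr 1
      ext θs
      simp
    have h2 : Var[h; σ] ≤ b ^ 2 := by
      refine (variance_le_expectation_sq hh.aestronglyMeasurable).trans ?_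
      have : ∫ θ, (h ^ 2) θ ∂σ ≤ ∫ _, b ^ 2 ∂σ := by
        refine integral_mono hL.integrable_sq (integrable_const _) fun θ => ?_
        exact sq_le_sq' (abs_le.1 (hb θ)).1 (abs_le.1 (hb θ)).2
      simpa using this
    simp only [empMean]
    rw [variance_const_mul, h1]
    calc (1 / (M : ℝ)) ^ 2 * (M * Var[h; σ]) = Var[h; σ] / M := by field_simp
      _ ≤ b ^ 2 / M := by gcongr
  have hsq : (∫ θs, |empMean θs h - a| ∂μ) ^ 2 ≤ b ^ 2 / M := by
    -- Jensen's inequality, read off from the nonnegativity of the variance of the absolute error: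
    -- the second moment of that error is the variance of the average, since `a` is its mean.
    have h3 := variance_nonneg (fun θs : Fin M → Θ => |empMean θs h - a|) μ
    rw [variance_eq_sub hLa] at h3
    have h4 : ∫ θs, ((fun θs : Fin M → Θ => |empMean θs h - a|) ^ 2) θs ∂μ
        = Var[fun θs : Fin M → Θ => empMean θs h; μ] := by
      rw [variance_eq_integral hem.aemeasurable, hmean]
      simp only [Pi.pow_apply, sq_abs]
    rw [h4] at h3
    linarith
  have hb0 : 0 ≤ b := by
    obtain ⟨θ⟩ : Nonempty Θ := nonempty_of_isProbabilityMeasure σ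
    exact (abs_nonneg _).trans (hb θ)
  rw [← ofReal_integral_eq_lintegral_ofReal (hLa.integrable one_le_two)
    (ae_of_all _ fun _ => abs_nonneg _)]
  refine ENNReal.ofReal_le_ofReal (abs_le_of_sq_le_sq' ?_ (by positivity)).2
  rwa [div_pow, Real.sq_sqrt hM'.le]

end EmpiricalMean

/-! ### Convergence in mean under measures of varying mass -/

section L1Convergence

variable {ι : Type*} {α : ι → Type*} [∀ i, MeasurableSpace (α i)]

/-- If the masses of the measures `μ i` converge and `Y i` converges in mean to a constant `a`, then
so do the integrals of a nonnegative function `g` of `Y i` which is continuous at `a`, provided that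
it is bounded along `Y i`. -/
theorem tendsto_lintegral_comp_of_tendsto_mean {l : Filter ι} (μ : ∀ i, Measure (α i))
    (Y : ∀ i, α i → ℝ) (hY : ∀ i, Measurable (Y i)) {a : ℝ} {m : ENNReal} (hm : m ≠ ⊤)
    (hmass : Tendsto (fun i => μ i Set.univ) l (𝓝 m))
    (hmean : Tendsto (fun i => ∫⁻ x, ENNReal.ofReal |Y i x - a| ∂(μ i)) l (𝓝 0))
    {g : ℝ → ℝ} (hg : Measurable g) (hga : ContinuousAt g a) {K : ℝ}
    (hK : ∀ᶠ i in l, ∀ᵐ x ∂(μ i), |g (Y i x)| ≤ K) :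
    Tendsto (fun i => ∫⁻ x, ENNReal.ofReal (g (Y i x)) ∂(μ i)) l (𝓝 (ENNReal.ofReal (g a) * m)) := by
  have hd : Tendsto (fun i => ∫⁻ x, ENNReal.ofReal |g (Y i x) - g a| ∂(μ i)) l (𝓝 0) := by
    rw [ENNReal.tendsto_nhds_zero]
    intro ε hε
    obtain ⟨ε', hε', hεm⟩ : ∃ ε' : ℝ, 0 < ε' ∧ ENNReal.ofReal ε' * m < ε := by
      have : Tendsto (fun r : ℝ => ENNReal.ofReal r * m) (𝓝[>] 0) (𝓝 (ENNReal.ofReal 0 * m)) :=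
        ENNReal.Tendsto.mul_const
          ((ENNReal.continuous_ofReal.tendsto 0).mono_left nhdsWithin_le_nhds) (Or.inr hm)
      rw [ENNReal.ofReal_zero, zero_mul] at this
      obtain ⟨r, hr, hr0⟩ := ((this.eventually (gt_mem_nhds hε)).and self_mem_nhdsWithin).exists
      exact ⟨r, hr0, hr⟩
    obtain ⟨δ, hδ, hδg⟩ := Metric.continuousAt_iff.1 hga ε' hε'
    -- Where `|Y i x - a| < δ` the error is below `ε'`; elsewhere it is at most `K + |g a|`, hence
    -- at most `(K + |g a|) / δ * |Y i x - a|`, as in Markov's inequality.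
    have hlim : Tendsto (fun i => ENNReal.ofReal ε' * μ i Set.univ
        + ENNReal.ofReal ((K + |g a|) / δ) * ∫⁻ x, ENNReal.ofReal |Y i x - a| ∂(μ i)) l
        (𝓝 (ENNReal.ofReal ε' * m + ENNReal.ofReal ((K + |g a|) / δ) * 0)) :=
      (ENNReal.Tendsto.const_mul hmass (Or.inr ENNReal.ofReal_ne_top)).add
        (ENNReal.Tendsto.const_mul hmean (Or.inr ENNReal.ofReal_ne_top))
    rw [mul_zero, add_zero] at hlim
    filter_upwards [hlim.eventually (gt_mem_nhds hεm), hK] with i hi hKi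
    refine le_trans ?_ hi.le
    rw [← lintegral_const, ← lintegral_const_mul _ (by fun_prop),
      ← lintegral_add_left measurable_const]
    refine lintegral_mono_ae ?_
    filter_upwards [hKi] with x hx
    by_cases hxδ : |Y i x - a| < δ
    · exact le_add_right (ENNReal.ofReal_le_ofReal (hδg (by rwa [Real.dist_eq])).le)
    · refine le_add_left ?_
      rw [← ENNReal.ofReal_mul (div_nonneg (add_nonneg ((abs_nonneg _).trans hx) (abs_nonneg _))
        hδ.le)]
      refine ENNReal.ofReal_le_ofReal ((abs_sub _ _).trans ?_)
      have h1 : 0 ≤ K + |g a| := add_nonneg ((abs_nonneg _).trans hx) (abs_nonneg _)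
      have h2 : δ ≤ |Y i x - a| := not_lt.1 hxδ
      rw [div_mul_eq_mul_div, le_div_iff₀ hδ]
      exact mul_le_mul (by linarith) h2 hδ.le h1
  have hmeas : ∀ i, Measurable fun x => ENNReal.ofReal |g (Y i x) - g a| := fun i =>
    ((hg.comp (hY i)).sub_const _).abs.ennreal_ofReal
  have hc : Tendsto (fun i => ENNReal.ofReal (g a) * μ i Set.univ) l
      (𝓝 (ENNReal.ofReal (g a) * m)) :=
    ENNReal.Tendsto.const_mul hmass (Or.inr ENNReal.ofReal_ne_top)
  -- Subtraction is truncated at zero here, which is harmless in a lower bound.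
  have hlow := ENNReal.Tendsto.sub hc hd (Or.inr ENNReal.zero_ne_top)
  have hupp := hc.add hd
  rw [tsub_zero] at hlow
  rw [add_zero] at hupp
  refine tendsto_of_tendsto_of_tendsto_of_le_of_le hlow hupp (fun i => ?_) (fun i => ?_)
  · simp only
    rw [tsub_le_iff_right, ← lintegral_const, ← lintegral_add_right _ (hmeas i)]
    refine lintegral_mono fun x => ?_
    refine le_trans (ENNReal.ofReal_le_ofReal ?_) ENNReal.ofReal_add_le
    linarith [neg_abs_le (g (Y i x) - g a)]
  · simp only
    rw [← lintegral_const, ← lintegral_add_right _ (hmeas i)]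
    refine lintegral_mono fun x => ?_
    refine le_trans (ENNReal.ofReal_le_ofReal ?_) ENNReal.ofReal_add_le
    linarith [le_abs_self (g (Y i x) - g a)]

end L1Convergence

/-! ### A reference measure on the parameter space -/

/-- A measure that dominates a given one and whose null sets are preserved by countably many
kernels. -/
theorem exists_sFinite_absolutelyContinuous_bind {Θ : Type*} [MeasurableSpace Θ]
    (κ : ℕ → Kernel Θ Θ) [∀ M, IsMarkovKernel (κ M)] (μ : Measure Θ) [SFinite μ] :
    ∃ ν : Measure Θ, SFinite ν ∧ μ ≪ ν ∧ ∀ M, ν.bind (κ M) ≪ ν := by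
  -- `S n` sums the images of `μ` under all compositions of `n` of the kernels. The sum over `n` is
  -- only s-finite, which is all that is used later.
  let S : ℕ → {ρ : Measure Θ // SFinite ρ} := fun n => Nat.rec ⟨μ, inferInstance⟩
    (fun _ ρ => ⟨Measure.sum fun M => ρ.1.bind (κ M), by have := ρ.2; infer_instance⟩) n
  have hS : ∀ n, (S (n + 1)).1 = Measure.sum fun M => (S n).1.bind (κ M) := fun n => rfl
  refine ⟨Measure.sum fun n => (S n).1, ?_, ?_, fun M => ?_⟩
  · have := fun n => (S n).2
    infer_instance
  · exact Measure.absolutelyContinuous_of_le (Measure.le_sum (fun n => (S n).1) 0)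
  -- The image of `S n` under `κ M` is one of the summands of `S (n + 1)`, so a null set of the
  -- total is null for it.
  · refine Measure.AbsolutelyContinuous.mk fun A hA h0 => ?_
    rw [Measure.sum_apply _ hA, ENNReal.tsum_eq_zero] at h0
    rw [Measure.bind_apply hA (κ M).aemeasurable, lintegral_sum_measure, ENNReal.tsum_eq_zero]
    intro n
    have := h0 (n + 1)
    rw [hS, Measure.sum_apply _ hA, ENNReal.tsum_eq_zero] at this
    rw [← Measure.bind_apply hA (κ M).aemeasurable]
    exact this M

variable {X Ξ : Type u} {Θ : Type} [MeasurableSpace X] [MeasurableSpace Ξ] [MeasurableSpace Θ]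
  {lam : Measure X} {rho : Measure Ξ}

/-! ### The posterior and Bayes' update -/

section Posterior

variable (P : DesignModel X Ξ Θ lam rho)

theorem measurable_lik_right (t : ℕ) (z : Traj X Ξ t) (zn : X × Ξ) : Measurable (P.lik t z zn) :=
  (P.measurable_lik t).comp (measurable_const.prodMk (measurable_const.prodMk measurable_id))

theorem measurable_trans_right (t : ℕ) (z : Traj X Ξ t) (zn : X × Ξ) :
    Measurable (P.trans t z zn) :=
  (P.measurable_trans t).comp (measurable_const.prodMk (measurable_const.prodMk measurable_id))

theorem measurable_fullLik_right : ∀ (t : ℕ) (z : Traj X Ξ t), Measurable (P.fullLik t z)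
  | 0, _ => measurable_const
  | t + 1, z => (measurable_fullLik_right t z.1).mul (P.measurable_lik_right t z.1 z.2)

variable {P}
  (hlik : ∀ (s : ℕ) (z : Traj X Ξ s) (zn : X × Ξ),
    (∀ θ, 0 < P.lik s z zn θ) ∧ ∃ C : ℝ, ∀ θ, P.lik s z zn θ ≤ C)

include hlik

theorem fullLik_pos : ∀ (t : ℕ) (z : Traj X Ξ t) (θ : Θ), 0 < P.fullLik t z θ
  | 0, _, _ => one_pos
  | t + 1, z, θ => mul_pos (fullLik_pos t z.1 θ) ((hlik t z.1 z.2).1 θ)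

theorem exists_fullLik_le : ∀ (t : ℕ) (z : Traj X Ξ t), ∃ C : ℝ, ∀ θ, P.fullLik t z θ ≤ C
  | 0, _ => ⟨1, fun _ => le_rfl⟩
  | t + 1, z => by
    obtain ⟨C, hC⟩ := exists_fullLik_le t z.1
    obtain ⟨C', hC'⟩ := (hlik t z.1 z.2).2
    exact ⟨C * C', fun θ => mul_le_mul (hC θ) (hC' θ) ((hlik t z.1 z.2).1 θ).le
      ((fullLik_pos hlik t z.1 θ).le.trans (hC θ))⟩

theorem integrable_fullLik (t : ℕ) (z : Traj X Ξ t) : Integrable (P.fullLik t z) P.prior := by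
  obtain ⟨C, hC⟩ := exists_fullLik_le hlik t z
  refine Integrable.of_bound (P.measurable_fullLik_right t z).aestronglyMeasurable C
    (ae_of_all _ fun θ => ?_)
  rw [Real.norm_of_nonneg (fullLik_pos hlik t z θ).le]
  exact hC θ

theorem integral_fullLik_pos (t : ℕ) (z : Traj X Ξ t) : 0 < ∫ θ, P.fullLik t z θ ∂P.prior := by
  rw [integral_pos_iff_support_of_nonneg (fun θ => (fullLik_pos hlik t z θ).le)
    (integrable_fullLik hlik t z)]
  have : Function.support (P.fullLik t z) = Set.univ :=
    Set.eq_univ_of_forall fun θ => (fullLik_pos hlik t z θ).ne'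
  rw [this, measure_univ]
  exact one_pos

/-- No integrability of `h` is needed, since the change of density holds for Bochner integrals
unconditionally. Writing posterior integrals as ratios of prior integrals lets the normalizing
constants cancel in Bayes' update. -/
theorem integral_posterior (t : ℕ) (z : Traj X Ξ t) (h : Θ → ℝ) :
    ∫ θ, h θ ∂(P.posterior t z)
      = (∫ θ, P.fullLik t z θ ∂P.prior)⁻¹ * ∫ θ, P.fullLik t z θ * h θ ∂P.prior := by
  have h0 : ∀ θ, 0 ≤ P.fullLik t z θ := fun θ => (fullLik_pos hlik t z θ).le
  rw [posterior, integral_smul_measure,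
    integral_withDensity_eq_integral_toReal_smul (P.measurable_fullLik_right t z).ennreal_ofReal
      (ae_of_all _ fun _ => ENNReal.ofReal_lt_top),
    ← ofReal_integral_eq_lintegral_ofReal (integrable_fullLik hlik t z) (ae_of_all _ h0),
    ENNReal.toReal_inv, ENNReal.toReal_ofReal (integral_nonneg h0), smul_eq_mul]
  simp only [ENNReal.toReal_ofReal (h0 _), smul_eq_mul]

theorem isProbabilityMeasure_posterior (t : ℕ) (z : Traj X Ξ t) :
    IsProbabilityMeasure (P.posterior t z) := by
  have h0 : ∀ θ, 0 ≤ P.fullLik t z θ := fun θ => (fullLik_pos hlik t z θ).le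
  refine ⟨?_⟩
  rw [posterior, Measure.smul_apply, withDensity_apply _ MeasurableSet.univ, setLIntegral_univ,
    smul_eq_mul, ← ofReal_integral_eq_lintegral_ofReal (integrable_fullLik hlik t z)
      (ae_of_all _ h0)]
  exact ENNReal.inv_mul_cancel (ENNReal.ofReal_pos.2 (integral_fullLik_pos hlik t z)).ne'
    ENNReal.ofReal_ne_top

/-- The integral of a bounded positive function against the posterior is positive. -/
theorem integral_posterior_pos (t : ℕ) (z : Traj X Ξ t) {h : Θ → ℝ} (hh : Measurable h)
    (h0 : ∀ θ, 0 < h θ) {C : ℝ} (hC : ∀ θ, h θ ≤ C) : 0 < ∫ θ, h θ ∂(P.posterior t z) := by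
  have := isProbabilityMeasure_posterior hlik t z
  rw [integral_pos_iff_support_of_nonneg (fun θ => (h0 θ).le)
    (Integrable.of_bound hh.aestronglyMeasurable C (ae_of_all _ fun θ => by
      rw [Real.norm_of_nonneg (h0 θ).le]; exact hC θ))]
  have : Function.support h = Set.univ := Set.eq_univ_of_forall fun θ => (h0 θ).ne'
  rw [this, measure_univ]
  exact one_pos

/-- Bayes' update of the posterior. -/
theorem integral_posterior_succ (t : ℕ) (z : Traj X Ξ t) (zn : X × Ξ) (h : Θ → ℝ) :
    ∫ θ, h θ ∂(P.posterior (t + 1) (z, zn))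
      = (∫ θ, P.lik t z zn θ * h θ ∂(P.posterior t z)) / ∫ θ, P.lik t z zn θ ∂(P.posterior t z) := by
  refine (integral_posterior hlik (t + 1) (z, zn) h).trans ?_
  rw [integral_posterior hlik, integral_posterior hlik]
  have h1 := (integral_fullLik_pos hlik t z).ne'
  have h2 : ∀ θ, P.fullLik (t + 1) (z, zn) θ = P.fullLik t z θ * P.lik t z zn θ := fun _ => rfl
  simp only [h2, mul_assoc]
  rw [mul_div_mul_left _ _ (inv_ne_zero h1), div_eq_inv_mul]

theorem policy_pos (t : ℕ) (z : Traj X Ξ t) (ξ : Ξ) [Nonempty X] : 0 < P.policy t z ξ := by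
  obtain ⟨θ⟩ : Nonempty Θ := nonempty_of_isProbabilityMeasure P.prior
  obtain ⟨x⟩ := ‹Nonempty X›
  refine (P.policy_nonneg t z ξ).lt_of_ne' fun h => ?_
  have := (hlik t z (x, ξ)).1 θ
  simp [lik, h] at this

end Posterior

/-! ### The law of the current particles along a trajectory -/

section ParticleLaw

variable (P : DesignModel X Ξ Θ lam rho)

/-- The law of one particle after resampling and jittering. -/
def jitterMixture (κ : Kernel Θ Θ) {M : ℕ} (t : ℕ) (z : Traj X Ξ t) (zn : X × Ξ)
    (θs : Fin M → Θ) : Measure Θ :=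
  ∑ k, ENNReal.ofReal (P.weight t z zn θs k) • κ (θs k)

/-- Ancestor indices play no role in later steps. Forgetting the index leaves a mixture of the
jittering kernels. -/
theorem map_snd_resampleJitter (κ : Kernel Θ Θ) [IsMarkovKernel κ] {M : ℕ} (t : ℕ)
    (z : Traj X Ξ t) (zn : X × Ξ) (θs : Fin M → Θ) :
    (P.resampleJitter κ t z zn θs).map Prod.snd = P.jitterMixture κ t z zn θs := by
  ext s hs
  rw [Measure.map_apply measurable_snd hs, resampleJitter, jitterMixture,
    Measure.finsetSum_apply, Measure.finsetSum_apply]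
  refine Finset.sum_congr rfl fun k _ => ?_
  rw [Measure.smul_apply, Measure.smul_apply, ← Measure.map_apply measurable_snd hs,
    Measure.map_snd_prod, measure_univ, one_smul]

instance isFiniteMeasure_jitterMixture (κ : Kernel Θ Θ) [IsMarkovKernel κ] {M : ℕ} (t : ℕ)
    (z : Traj X Ξ t) (zn : X × Ξ) (θs : Fin M → Θ) :
    IsFiniteMeasure (P.jitterMixture κ t z zn θs) := by
  rw [← map_snd_resampleJitter]
  infer_instance

/-- The mass can be 0 instead of 1, when `M = 0` or all likelihoods vanish, because division by zero
gives zero weights. The inequality holds in every case, so `particleKernel` is finite without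
positivity assumptions. -/
theorem jitterMixture_univ_le (κ : Kernel Θ Θ) [IsMarkovKernel κ] {M : ℕ} (t : ℕ)
    (z : Traj X Ξ t) (zn : X × Ξ) (θs : Fin M → Θ) :
    P.jitterMixture κ t z zn θs Set.univ ≤ 1 := by
  rw [← map_snd_resampleJitter, Measure.map_apply measurable_snd MeasurableSet.univ]
  exact P.resampleJitter_univ_le κ t z zn θs

variable {P} in
theorem sum_weight (hlik : ∀ (s : ℕ) (z : Traj X Ξ s) (zn : X × Ξ),
      (∀ θ, 0 < P.lik s z zn θ) ∧ ∃ C : ℝ, ∀ θ, P.lik s z zn θ ≤ C)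
    {M : ℕ} (hM : 1 ≤ M) (t : ℕ) (z : Traj X Ξ t) (zn : X × Ξ) (θs : Fin M → Θ) :
    ∑ k, P.weight t z zn θs k = 1 := by
  have : NeZero M := ⟨by omega⟩
  simp only [weight]
  rw [← Finset.sum_div]
  exact div_self (Finset.sum_pos (fun m _ => (hlik t z zn).1 _) Finset.univ_nonempty).ne'

theorem weight_nonneg {M : ℕ} (t : ℕ) (z : Traj X Ξ t) (zn : X × Ξ) (θs : Fin M → Θ) (k : Fin M) :
    0 ≤ P.weight t z zn θs k :=
  div_nonneg (P.lik_nonneg _ _ _ _) (Finset.sum_nonneg fun _ _ => P.lik_nonneg _ _ _ _)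

variable {P} in
theorem isProbabilityMeasure_jitterMixture (hlik : ∀ (s : ℕ) (z : Traj X Ξ s) (zn : X × Ξ),
      (∀ θ, 0 < P.lik s z zn θ) ∧ ∃ C : ℝ, ∀ θ, P.lik s z zn θ ≤ C)
    (κ : Kernel Θ Θ) [IsMarkovKernel κ] {M : ℕ} (hM : 1 ≤ M) (t : ℕ)
    (z : Traj X Ξ t) (zn : X × Ξ) (θs : Fin M → Θ) :
    IsProbabilityMeasure (P.jitterMixture κ t z zn θs) := by
  refine ⟨?_⟩
  simp only [jitterMixture, Measure.finsetSum_apply, Measure.smul_apply, smul_eq_mul,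
    measure_univ, mul_one]
  rw [← ENNReal.ofReal_sum_of_nonneg fun k _ => P.weight_nonneg _ _ _ _ _, sum_weight hlik hM,
    ENNReal.ofReal_one]

theorem measurable_jitterMixture (κ : Kernel Θ Θ) {M : ℕ} (t : ℕ) {s : Set Θ}
    (hs : MeasurableSet s) :
    Measurable fun q : (Traj X Ξ t × (X × Ξ)) × (Fin M → Θ) =>
      P.jitterMixture κ t q.1.1 q.1.2 q.2 s := by
  simp only [jitterMixture, Measure.finsetSum_apply, Measure.smul_apply, smul_eq_mul]
  have hθ : ∀ k : Fin M, Measurable fun q : (Traj X Ξ t × (X × Ξ)) × (Fin M → Θ) => q.2 k :=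
    fun k => (measurable_pi_apply k).comp measurable_snd
  have hl : ∀ k : Fin M, Measurable fun q : (Traj X Ξ t × (X × Ξ)) × (Fin M → Θ) =>
      P.lik t q.1.1 q.1.2 (q.2 k) := fun k =>
    (P.measurable_lik t).comp ((measurable_fst.comp measurable_fst).prodMk
      ((measurable_snd.comp measurable_fst).prodMk (hθ k)))
  exact Finset.measurable_sum _ fun k _ =>
    ((hl k).div (Finset.measurable_sum _ fun j _ => hl j)).ennreal_ofReal.mul
      ((κ.measurable_coe hs).comp (hθ k))

/-- The joint law of the `M` particles after resampling and jittering. -/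
def particleKernel (κ : Kernel Θ Θ) [IsMarkovKernel κ] (M t : ℕ) :
    Kernel ((Traj X Ξ t × (X × Ξ)) × (Fin M → Θ)) (Fin M → Θ) where
  toFun q := Measure.pi fun _ => P.jitterMixture κ t q.1.1 q.1.2 q.2
  measurable' := by
    refine Measurable.measure_of_isPiSystem generateFrom_pi.symm isPiSystem_pi ?_ ?_
    · rintro _ ⟨s, hs, rfl⟩
      simp only [Measure.pi_pi]
      exact Finset.measurable_prod _ fun m _ =>
        P.measurable_jitterMixture κ t (hs m (Set.mem_univ m))
    · simp only [Measure.pi_univ]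
      exact Finset.measurable_prod _ fun m _ => P.measurable_jitterMixture κ t MeasurableSet.univ

theorem particleKernel_apply (κ : Kernel Θ Θ) [IsMarkovKernel κ] (M t : ℕ)
    (q : (Traj X Ξ t × (X × Ξ)) × (Fin M → Θ)) :
    P.particleKernel κ M t q = Measure.pi fun _ => P.jitterMixture κ t q.1.1 q.1.2 q.2 := rfl

instance particleKernel_finite (κ : Kernel Θ Θ) [IsMarkovKernel κ] (M t : ℕ) :
    IsFiniteKernel (P.particleKernel κ M t) := by
  refine ⟨1, ENNReal.one_lt_top, fun q => ?_⟩
  rw [particleKernel_apply, Measure.pi_univ]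
  exact Finset.prod_le_one' fun m _ => P.jitterMixture_univ_le κ t _ _ _

/-- The pairs are independent given the past, so dropping the index in each coordinate yields the
product of the marginals. -/
theorem map_innerKernel (κ : Kernel Θ Θ) [IsMarkovKernel κ] (M t : ℕ)
    (y : NPath X Ξ Θ M t) (zn : X × Ξ) :
    (P.innerKernel κ M t (y, zn)).map (fun w m => (w m).2)
      = P.particleKernel κ M t ((NPath.traj t y, zn), NPath.particles t y) := by
  change (Measure.pi fun _ : Fin M =>
    P.resampleJitter κ t (NPath.traj t y) zn (NPath.particles t y)).map _ = _
  rw [particleKernel_apply]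
  simp only [← map_snd_resampleJitter]
  exact Measure.pi_map_pi fun _ => measurable_snd.aemeasurable

/-- `outerDensity` as a function of the trajectory and the particles. -/
def particleDensity (η : ℝ) {M : ℕ} (t : ℕ) (z : Traj X Ξ t) (zn : X × Ξ) (θs : Fin M → Θ) : ℝ :=
  empMean θs (P.lik t z zn) * Real.exp (-η * Real.log (empMean θs (P.trans t z zn)))

theorem measurable_particleDensity (η : ℝ) (M t : ℕ) :
    Measurable fun q : (Traj X Ξ t × (X × Ξ)) × (Fin M → Θ) =>
      P.particleDensity η t q.1.1 q.1.2 q.2 := by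
  have ha : ∀ k : Fin M, Measurable fun q : (Traj X Ξ t × (X × Ξ)) × (Fin M → Θ) =>
      (q.1.1, q.1.2, q.2 k) := fun k => by fun_prop
  refine Measurable.mul ?_ (Real.measurable_exp.comp
    ((Real.measurable_log.comp ?_).const_mul (-η)))
  · exact (Finset.measurable_sum _ fun k _ => (P.measurable_lik t).comp (ha k)).const_mul _
  · exact (Finset.measurable_sum _ fun k _ => (P.measurable_trans t).comp (ha k)).const_mul _

/-- The reweighted resample and jitter step. -/
def weightedKernel (κ : Kernel Θ Θ) [IsMarkovKernel κ] (η : ℝ) (M t : ℕ) :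
    Kernel ((Traj X Ξ t × (X × Ξ)) × (Fin M → Θ)) (Fin M → Θ) :=
  (P.particleKernel κ M t).withDensity fun q _ =>
    ENNReal.ofReal (P.particleDensity η t q.1.1 q.1.2 q.2)

instance weightedKernel_sfinite (κ : Kernel Θ Θ) [IsMarkovKernel κ] (η : ℝ) (M t : ℕ) :
    IsSFiniteKernel (P.weightedKernel κ η M t) :=
  Kernel.IsSFiniteKernel.withDensity _ fun _ _ => ENNReal.ofReal_ne_top

/-- The unnormalized law of the current particles of the nested filter given the trajectory. -/
def particleLaw (P : DesignModel X Ξ Θ lam rho) (κ : Kernel Θ Θ) [IsMarkovKernel κ] (η : ℝ) (M : ℕ) :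
    ∀ t, Kernel (Traj X Ξ t) (Fin M → Θ)
  | 0 => Kernel.const _ (Measure.pi fun _ => P.prior)
  -- There is no normalization: the reweighting factors accumulate in the total mass, which thereby
  -- records the density of the trajectory.
  | t + 1 =>
    ((P.particleLaw κ η M t).comap (Prod.fst : Traj X Ξ t × (X × Ξ) → Traj X Ξ t) measurable_fst
      ⊗ₖ P.weightedKernel κ η M t).snd

instance particleLaw_sfinite (P : DesignModel X Ξ Θ lam rho) (κ : Kernel Θ Θ) [IsMarkovKernel κ] (η : ℝ) (M : ℕ) :
    ∀ t, IsSFiniteKernel (P.particleLaw κ η M t)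
  | 0 => inferInstanceAs (IsSFiniteKernel (Kernel.const _ (Measure.pi fun _ => P.prior)))
  | t + 1 => by
    have := particleLaw_sfinite P κ η M t
    exact inferInstanceAs (IsSFiniteKernel ((P.particleLaw κ η M t).comap
      (Prod.fst : Traj X Ξ t × (X × Ξ) → Traj X Ξ t) measurable_fst
        ⊗ₖ P.weightedKernel κ η M t).snd)

theorem particleLaw_zero (κ : Kernel Θ Θ) [IsMarkovKernel κ] (η : ℝ) (M : ℕ) (z : Traj X Ξ 0) :
    P.particleLaw κ η M 0 z = Measure.pi fun _ => P.prior := rfl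

/-- The reweighting factor depends on the old particles only, so it leaves the integral over the new
ones. This recursion drives the later inductions on `t`. -/
theorem lintegral_particleLaw_succ (κ : Kernel Θ Θ) [IsMarkovKernel κ] (η : ℝ) (M t : ℕ)
    (z : Traj X Ξ t) (zn : X × Ξ) {ψ : (Fin M → Θ) → ENNReal} (hψ : Measurable ψ) :
    ∫⁻ θs, ψ θs ∂(P.particleLaw κ η M (t + 1) (z, zn))
      = ∫⁻ θs, ENNReal.ofReal (P.particleDensity η t z zn θs)
          * ∫⁻ θs', ψ θs' ∂(P.particleKernel κ M t ((z, zn), θs)) ∂(P.particleLaw κ η M t z) := by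
  have hd : Measurable (Function.uncurry
      fun (q : (Traj X Ξ t × (X × Ξ)) × (Fin M → Θ)) (_ : Fin M → Θ) =>
        ENNReal.ofReal (P.particleDensity η t q.1.1 q.1.2 q.2)) :=
    ((P.measurable_particleDensity η M t).comp measurable_fst).ennreal_ofReal
  change ∫⁻ θs, ψ θs ∂(((P.particleLaw κ η M t).comap
    (Prod.fst : Traj X Ξ t × (X × Ξ) → Traj X Ξ t) measurable_fst
      ⊗ₖ P.weightedKernel κ η M t).snd (z, zn)) = _
  rw [Kernel.lintegral_snd _ _ hψ, Kernel.lintegral_compProd _ _ _ (f := fun q => ψ q.2) (hψ.comp measurable_snd),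
    Kernel.lintegral_comap]
  refine lintegral_congr fun θs => ?_
  rw [weightedKernel, Kernel.lintegral_withDensity _ hd _ hψ, lintegral_const_mul _ hψ]

end ParticleLaw

/-! ### Disintegration of the nested target over trajectories -/

section Disintegration

instance ref_sfinite (P : DesignModel X Ξ Θ lam rho) [SigmaFinite lam] [SigmaFinite rho] :
    ∀ t, SFinite (P.ref t)
  | 0 => inferInstanceAs (SFinite P.init)
  | t + 1 =>
    haveI := ref_sfinite P t
    inferInstanceAs (SFinite ((P.ref t).prod (lam.prod rho)))

variable [SigmaFinite lam] [SigmaFinite rho] (P : DesignModel X Ξ Θ lam rho)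

/-- Under the unnormalized nested target, the current particles have the law `particleLaw` given the
trajectory, and the trajectory is distributed according to the reference measure. -/
theorem lintegral_nestedUnnorm (κ : Kernel Θ Θ) [IsMarkovKernel κ] (η : ℝ) (M : ℕ) :
    ∀ (t : ℕ) {ψ : Traj X Ξ t × (Fin M → Θ) → ENNReal}, Measurable ψ →
      ∫⁻ y, ψ (NPath.traj t y, NPath.particles t y) ∂(P.nestedUnnorm κ η M t)
        = ∫⁻ z, ∫⁻ θs, ψ (z, θs) ∂(P.particleLaw κ η M t z) ∂(P.ref t) := by
  intro t
  induction t with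
  | zero =>
    intro ψ hψ
    exact lintegral_prod (μ := P.init) (ν := Measure.pi fun _ : Fin M => P.prior) ψ hψ.aemeasurable
  | succ t ih =>
    intro ψ hψ
    let ψ' : (Traj X Ξ t × (X × Ξ)) × (Fin M → Θ) → ENNReal := ψ
    have hψ' : Measurable ψ' := hψ
    have hφ : Measurable fun y : NPath X Ξ Θ M t × ((X × Ξ) × (Fin M → Fin M × Θ)) =>
        ψ' ((NPath.traj t y.1, y.2.1), fun m => (y.2.2 m).2) := by
      have := NPath.measurable_traj (X := X) (Ξ := Ξ) (Θ := Θ) (M := M) t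
      fun_prop
    -- What is left of the integrand once the new indices and particles are integrated out. It sees
    -- the old path only through its trajectory and current particles, so the induction hypothesis
    -- applies to it.
    let R : (Traj X Ξ t × (X × Ξ)) × (Fin M → Θ) → ENNReal := fun q =>
      ENNReal.ofReal (P.particleDensity η t q.1.1 q.1.2 q.2)
        * ∫⁻ θs', ψ' (q.1, θs') ∂(P.particleKernel κ M t q)
    have hR : Measurable R := by
      refine (P.measurable_particleDensity η M t).ennreal_ofReal.mul ?_
      exact Measurable.lintegral_kernel_prod_right'
        (f := fun q : ((Traj X Ξ t × (X × Ξ)) × (Fin M → Θ)) × (Fin M → Θ) => ψ' (q.1.1, q.2))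
        (by fun_prop)
    have hR' : Measurable fun q : (Traj X Ξ t × (Fin M → Θ)) × (X × Ξ) =>
        R ((q.1.1, q.2), q.1.2) := by fun_prop
    have h1 : ∫⁻ y, ψ (NPath.traj (t + 1) y, NPath.particles (t + 1) y)
          ∂(P.nestedUnnorm κ η M (t + 1))
        = ∫⁻ y, ∫⁻ zn, R ((NPath.traj t y, zn), NPath.particles t y) ∂(lam.prod rho)
          ∂(P.nestedUnnorm κ η M t) := by
      change ∫⁻ y : NPath X Ξ Θ M t × ((X × Ξ) × (Fin M → Fin M × Θ)),
        ψ' ((NPath.traj t y.1, y.2.1), fun m => (y.2.2 m).2)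
          ∂((P.nestedUnnorm κ η M t) ⊗ₘ (P.outerKernel η M t ⊗ₖ P.innerKernel κ M t)) = _
      rw [Measure.lintegral_compProd hφ]
      refine lintegral_congr fun y => ?_
      have hφy : Measurable fun q : (X × Ξ) × (Fin M → Fin M × Θ) =>
          ψ' ((NPath.traj t y, q.1), fun m => (q.2 m).2) := hφ.comp measurable_prodMk_left
      rw [Kernel.lintegral_compProd _ _ _ (f := fun q : (X × Ξ) × (Fin M → Fin M × Θ) =>
        ψ' ((NPath.traj t y, q.1), fun m => (q.2 m).2)) hφy, outerKernel,
        Kernel.lintegral_withDensity _ (P.measurable_outerDensity η M t).ennreal_ofReal,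
        Kernel.const_apply]
      · refine lintegral_congr fun zn => ?_
        change ENNReal.ofReal (P.particleDensity η t (NPath.traj t y) zn (NPath.particles t y))
          * _ = _
        congr 1
        rw [← map_innerKernel]
        exact (lintegral_map (f := fun θs' => ψ' ((NPath.traj t y, zn), θs'))
          (hψ'.comp measurable_prodMk_left) (by fun_prop)).symm
      · exact Measurable.lintegral_kernel_prod_right' (κ := Kernel.comap (P.innerKernel κ M t)
          (fun zn : X × Ξ => (y, zn)) measurable_prodMk_left)
          (f := fun q : (X × Ξ) × (Fin M → Fin M × Θ) =>
            ψ' ((NPath.traj t y, q.1), fun m => (q.2 m).2)) hφy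
    rw [h1]
    have h2 := ih (ψ := fun q => ∫⁻ zn, R ((q.1, zn), q.2) ∂(lam.prod rho))
      (Measurable.lintegral_prod_right' hR')
    rw [h2]
    -- Tonelli: the filter draws `zn` given the particles, whereas the disintegration needs the
    -- particles given `zn`.
    have h3 : ∀ z, ∫⁻ θs, ∫⁻ zn, R ((z, zn), θs) ∂(lam.prod rho) ∂(P.particleLaw κ η M t z)
        = ∫⁻ zn, ∫⁻ θs, ψ ((z, zn), θs) ∂(P.particleLaw κ η M (t + 1) (z, zn)) ∂(lam.prod rho) := by
      intro z
      rw [lintegral_lintegral_swap]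
      · refine lintegral_congr fun zn => ?_
        exact (P.lintegral_particleLaw_succ κ η M t z zn
          (ψ := fun θs => ψ' ((z, zn), θs)) (hψ'.comp measurable_prodMk_left)).symm
      · exact (hR.comp (f := fun q : (Fin M → Θ) × (X × Ξ) => ((z, q.2), q.1))
          (by fun_prop)).aemeasurable
    simp only [h3]
    have hm : Measurable fun z : Traj X Ξ (t + 1) =>
        ∫⁻ θs, ψ (z, θs) ∂(P.particleLaw κ η M (t + 1) z) :=
      Measurable.lintegral_kernel_prod_right' hψ
    exact (lintegral_prod (μ := P.ref t) (ν := lam.prod rho)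
      (fun z : Traj X Ξ t × (X × Ξ) => ∫⁻ θs, ψ' (z, θs) ∂(P.particleLaw κ η M (t + 1) z))
      hm.aemeasurable).symm

/-- The mass of `particleLaw` is the density of the trajectory under the unnormalized nested
target. -/
theorem map_traj_nestedUnnorm (κ : Kernel Θ Θ) [IsMarkovKernel κ] (η : ℝ) (M t : ℕ) :
    (P.nestedUnnorm κ η M t).map (NPath.traj t)
      = (P.ref t).withDensity fun z => P.particleLaw κ η M t z Set.univ := by
  ext s hs
  rw [withDensity_apply _ hs, ← lintegral_indicator_one hs,
    lintegral_map (measurable_one.indicator hs) (NPath.measurable_traj t),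
    ← lintegral_indicator hs]
  refine (P.lintegral_nestedUnnorm κ η M t (ψ := fun q => s.indicator 1 q.1)
    ((measurable_one.indicator hs).comp measurable_fst)).trans (lintegral_congr fun z => ?_)
  by_cases hz : z ∈ s <;> simp [hz]

end Disintegration

/-! ### Error of one resample and jitter step -/

section OneStep

variable {P : DesignModel X Ξ Θ lam rho}
  (hlik : ∀ (s : ℕ) (z : Traj X Ξ s) (zn : X × Ξ),
    (∀ θ, 0 < P.lik s z zn θ) ∧ ∃ C : ℝ, ∀ θ, P.lik s z zn θ ≤ C)

variable (P) in
theorem integral_jitterMixture (κ : Kernel Θ Θ) [IsMarkovKernel κ] {M : ℕ} (t : ℕ)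
    (z : Traj X Ξ t) (zn : X × Ξ) (θs : Fin M → Θ) {h : Θ → ℝ} (hh : Measurable h) {b : ℝ}
    (hb : ∀ θ, |h θ| ≤ b) :
    ∫ θ, h θ ∂(P.jitterMixture κ t z zn θs)
      = ∑ k, P.weight t z zn θs k * ∫ θ, h θ ∂(κ (θs k)) := by
  have hi : ∀ k, Integrable h (κ (θs k)) := fun k =>
    Integrable.of_bound hh.aestronglyMeasurable b (ae_of_all _ hb)
  rw [jitterMixture, integral_finsetSum_measure fun k _ =>
    (hi k).smul_measure ENNReal.ofReal_ne_top]
  refine Finset.sum_congr rfl fun k _ => ?_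
  rw [integral_smul_measure, ENNReal.toReal_ofReal (P.weight_nonneg _ _ _ _ _), smul_eq_mul]

include hlik

/-- Jittering changes the integral of `h` by at most the maximal perturbation of `h` by `κ`. -/
theorem abs_integral_jitterMixture_sub_le (κ : Kernel Θ Θ) [IsMarkovKernel κ] {M : ℕ} (hM : 1 ≤ M)
    (t : ℕ) (z : Traj X Ξ t) (zn : X × Ξ) (θs : Fin M → Θ) {h : Θ → ℝ} (hh : Measurable h) {b : ℝ}
    (hb : ∀ θ, |h θ| ≤ b) {δ : ℝ} (hδ : ∀ θ', ∫ θ, |h θ - h θ'| ∂(κ θ') ≤ δ) :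
    |∫ θ, h θ ∂(P.jitterMixture κ t z zn θs) - ∑ k, P.weight t z zn θs k * h (θs k)| ≤ δ := by
  rw [P.integral_jitterMixture κ t z zn θs hh hb, ← Finset.sum_sub_distrib]
  calc |∑ k, (P.weight t z zn θs k * ∫ θ, h θ ∂(κ (θs k)) - P.weight t z zn θs k * h (θs k))|
      ≤ ∑ k, |P.weight t z zn θs k * ∫ θ, h θ ∂(κ (θs k)) - P.weight t z zn θs k * h (θs k)| :=
        Finset.abs_sum_le_sum_abs _ _
    _ ≤ ∑ k, P.weight t z zn θs k * δ := by
        refine Finset.sum_le_sum fun k _ => ?_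
        have hi : Integrable h (κ (θs k)) :=
          Integrable.of_bound hh.aestronglyMeasurable b (ae_of_all _ hb)
        rw [← mul_sub, abs_mul, abs_of_nonneg (P.weight_nonneg _ _ _ _ _)]
        refine mul_le_mul_of_nonneg_left (le_trans ?_ (hδ (θs k))) (P.weight_nonneg _ _ _ _ _)
        have : ∫ θ, h θ ∂(κ (θs k)) - h (θs k) = ∫ θ, (h θ - h (θs k)) ∂(κ (θs k)) := by
          rw [integral_sub hi (integrable_const _)]; simp
        rw [this]
        exact abs_integral_le_integral_abs
    _ = δ := by rw [← Finset.sum_mul, sum_weight hlik hM, one_mul]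

/-- The error of the self-normalized average, in terms of those of its numerator and denominator. -/
theorem abs_sum_weight_sub_le {M : ℕ} (hM : 1 ≤ M) (t : ℕ) (z : Traj X Ξ t) (zn : X × Ξ)
    (θs : Fin M → Θ) {h : Θ → ℝ} {b : ℝ} (hb : ∀ θ, |h θ| ≤ b) {n a : ℝ} (ha : 0 < a) :
    |∑ k, P.weight t z zn θs k * h (θs k) - n / a|
      ≤ a⁻¹ * (|empMean θs (fun θ => P.lik t z zn θ * h θ) - n|
          + b * |empMean θs (P.lik t z zn) - a|) := by
  have hM' : (0 : ℝ) < M := by exact_mod_cast hM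
  have : NeZero M := ⟨by omega⟩
  set S := ∑ k, P.weight t z zn θs k * h (θs k)
  have hS : |S| ≤ b := by
    calc |S| ≤ ∑ k, |P.weight t z zn θs k * h (θs k)| := Finset.abs_sum_le_sum_abs _ _
      _ ≤ ∑ k, P.weight t z zn θs k * b := by
        refine Finset.sum_le_sum fun k _ => ?_
        rw [abs_mul, abs_of_nonneg (P.weight_nonneg _ _ _ _ _)]
        exact mul_le_mul_of_nonneg_left (hb _) (P.weight_nonneg _ _ _ _ _)
      _ = b := by rw [← Finset.sum_mul, sum_weight hlik hM, one_mul]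
  have hp : 0 < ∑ j, P.lik t z zn (θs j) :=
    Finset.sum_pos (fun m _ => (hlik t z zn).1 _) Finset.univ_nonempty
  have hnum : empMean θs (fun θ => P.lik t z zn θ * h θ) = S * empMean θs (P.lik t z zn) := by
    simp only [S, empMean, weight, div_mul_eq_mul_div]
    rw [← Finset.sum_div]
    field_simp
  rw [hnum]
  set e := empMean θs (P.lik t z zn)
  -- Only the deterministic limit `a` is inverted. The random denominator `e` may be close to zero,
  -- but it is never divided by in this form, and `|S| ≤ b` controls the last term.
  have : S - n / a = a⁻¹ * ((S * e - n) - S * (e - a)) := by field_simp; ring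
  rw [this, abs_mul, abs_of_pos (inv_pos.2 ha)]
  refine mul_le_mul_of_nonneg_left ((abs_sub _ _).trans ?_) (inv_pos.2 ha).le
  rw [abs_mul]
  gcongr

/-- The error of the particle approximation after one resample and jitter step. -/
theorem lintegral_abs_sub_particleKernel_le (κ : Kernel Θ Θ) [IsMarkovKernel κ] {M : ℕ}
    (hM : 1 ≤ M) (t : ℕ) (z : Traj X Ξ t) (zn : X × Ξ) (θs : Fin M → Θ) {h : Θ → ℝ}
    (hh : Measurable h) {b : ℝ} (hb0 : 0 ≤ b) (hb : ∀ θ, |h θ| ≤ b) {δ : ℝ}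
    (hδ : ∀ θ', ∫ θ, |h θ - h θ'| ∂(κ θ') ≤ δ) {n a : ℝ} (ha : 0 < a) :
    ∫⁻ θs', ENNReal.ofReal |empMean θs' h - n / a| ∂(P.particleKernel κ M t ((z, zn), θs))
      ≤ ENNReal.ofReal (b / Real.sqrt M) + ENNReal.ofReal δ
        + ENNReal.ofReal a⁻¹ * (ENNReal.ofReal |empMean θs (fun θ => P.lik t z zn θ * h θ) - n|
          + ENNReal.ofReal b * ENNReal.ofReal |empMean θs (P.lik t z zn) - a|) := by
  have := isProbabilityMeasure_jitterMixture hlik κ hM t z zn θs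
  rw [particleKernel_apply]
  set σ := P.jitterMixture κ t z zn θs
  set S := ∑ k, P.weight t z zn θs k * h (θs k)
  have h1 := lintegral_abs_empMean_sub_le σ hM hh hb
  have h2 : |∫ θ, h θ ∂σ - S| ≤ δ :=
    abs_integral_jitterMixture_sub_le hlik κ hM t z zn θs hh hb hδ
  have h3 : |S - n / a| ≤ _ := abs_sum_weight_sub_le hlik hM t z zn θs hb (n := n) ha
  have h3' : ENNReal.ofReal |S - n / a|
      ≤ ENNReal.ofReal a⁻¹ * (ENNReal.ofReal |empMean θs (fun θ => P.lik t z zn θ * h θ) - n|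
          + ENNReal.ofReal b * ENNReal.ofReal |empMean θs (P.lik t z zn) - a|) := by
    rw [← ENNReal.ofReal_mul hb0, ← ENNReal.ofReal_add (abs_nonneg _) (by positivity),
      ← ENNReal.ofReal_mul (inv_pos.2 ha).le]
    exact ENNReal.ofReal_le_ofReal h3
  -- Three errors: Monte Carlo fluctuation around the mixture, bias from jittering, and the
  -- self-normalized average before jittering.
  calc ∫⁻ θs', ENNReal.ofReal |empMean θs' h - n / a| ∂(Measure.pi fun _ : Fin M => σ)
      ≤ ∫⁻ θs', (ENNReal.ofReal |empMean θs' h - ∫ θ, h θ ∂σ|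
          + (ENNReal.ofReal δ + ENNReal.ofReal |S - n / a|)) ∂(Measure.pi fun _ : Fin M => σ) := by
        refine lintegral_mono fun θs' => ?_
        refine le_trans (ENNReal.ofReal_le_ofReal ?_)
          (ENNReal.ofReal_add_le.trans (add_le_add_right ENNReal.ofReal_add_le _))
        have e : empMean θs' h - n / a = (empMean θs' h - ∫ θ, h θ ∂σ)
          + ((∫ θ, h θ ∂σ - S) + (S - n / a)) := by ring
        rw [e]
        exact (abs_add_le _ _).trans (add_le_add_right ((abs_add_le _ _).trans
          (add_le_add_left h2 _)) _)
    _ ≤ _ := by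
        rw [lintegral_add_right _ measurable_const, lintegral_const, measure_univ, mul_one,
          add_assoc]
        exact add_le_add h1 (add_le_add_right h3' _)

end OneStep

/-! ### A measurable dominating function -/

section EssEnvelope

/-- The analogue of `envelope` with essential suprema; unlike `envelope`, it is measurable. -/
def essEnvelope (P : DesignModel X Ξ Θ lam rho) (ν : Measure Θ) (η : ℝ) :
    ∀ t, Traj X Ξ t → ENNReal
  | 0, _ => 1
  | t + 1, z => P.essEnvelope ν η t z.1 * (ENNReal.ofReal (P.policy t z.1 z.2.2) *
      essSup (fun θ => ENNReal.ofReal (P.trans t z.1 z.2 θ ^ (1 - η))) ν)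

/-- The essential supremum is at most `c` exactly when the section of `{c < F}` is null, and the
measure of a section is a measurable function for s-finite `ν`. -/
theorem _root_.Measurable.essSup_prod_right {α β : Type*} [MeasurableSpace α] [MeasurableSpace β]
    {ν : Measure β} [SFinite ν] {F : α × β → ENNReal} (hF : Measurable F) :
    Measurable fun x => essSup (fun y => F (x, y)) ν := by
  refine measurable_of_Iic fun c => ?_
  have : (fun x => essSup (fun y => F (x, y)) ν) ⁻¹' Set.Iic c
      = {x | ν (Prod.mk x ⁻¹' {q | c < F q}) = 0} := by
    ext x
    have h : (∀ᵐ y ∂ν, F (x, y) ≤ c) ↔ ν (Prod.mk x ⁻¹' {q | c < F q}) = 0 := by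
      rw [ae_iff]; simp only [not_le]; rfl
    simp only [Set.mem_preimage, Set.mem_Iic, Set.mem_ofPred_eq]
    rw [← h]
    refine ⟨fun hx => ?_, fun hx => essSup_le_of_ae_le c hx⟩
    filter_upwards [ENNReal.ae_le_essSup (fun y => F (x, y))] with y hy using hy.trans hx
  rw [this]
  exact measurable_measure_prodMk_left (measurableSet_lt measurable_const hF)
    (measurableSet_singleton 0)

variable (P : DesignModel X Ξ Θ lam rho) (ν : Measure Θ)

theorem measurable_essEnvelope [SFinite ν] (η : ℝ) : ∀ t, Measurable (P.essEnvelope ν η t)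
  | 0 => measurable_const
  | t + 1 => by
    have hp : Measurable fun z : Traj X Ξ t × (X × Ξ) => P.policy t z.1 z.2.2 :=
      (P.policy_measurable t).comp (f := fun z : Traj X Ξ t × (X × Ξ) => (z.1, z.2.2))
        (by fun_prop)
    have ht : Measurable fun q : (Traj X Ξ t × (X × Ξ)) × Θ =>
        ENNReal.ofReal (P.trans t q.1.1 q.1.2 q.2 ^ (1 - η)) :=
      (((P.measurable_trans t).comp (f := fun q : (Traj X Ξ t × (X × Ξ)) × Θ =>
        (q.1.1, q.1.2, q.2)) (by fun_prop)).pow_const _).ennreal_ofReal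
    exact ((measurable_essEnvelope η t).comp measurable_fst).mul
      (hp.ennreal_ofReal.mul ht.essSup_prod_right)

/-- Transfers the integrability hypothesis: the Lebesgue integral of a possibly nonmeasurable
`envelope` is a lower integral, and so still bounds that of a measurable minorant. -/
theorem essEnvelope_le_envelope (η : ℝ) :
    ∀ (t : ℕ) (z : Traj X Ξ t), P.essEnvelope ν η t z ≤ P.envelope η t z
  | 0, _ => le_rfl
  | t + 1, z => mul_le_mul' (essEnvelope_le_envelope η t z.1) (mul_le_mul' le_rfl
      (essSup_le_of_ae_le _ (ae_of_all _ fun θ =>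
        le_iSup (fun θ => ENNReal.ofReal (P.trans t z.1 z.2 θ ^ (1 - η))) θ)))

variable {P ν}
variable (hlik : ∀ (s : ℕ) (z : Traj X Ξ s) (zn : X × Ξ),
    (∀ θ, 0 < P.lik s z zn θ) ∧ ∃ C : ℝ, ∀ θ, P.lik s z zn θ ≤ C)
  (hf : ∀ (x : X) (ξ : Ξ) (x' : X),
    (∀ θ, 0 < P.f x ξ θ x') ∧ ∃ C : ℝ, ∀ θ, P.f x ξ θ x' ≤ C)
include hlik hf

/-- Positivity excludes products `0 * ⊤`, so that finiteness at time `t + 1` can be passed back to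
both factors. -/
theorem essEnvelope_pos [NeZero ν] (η : ℝ) : ∀ (t : ℕ) (z : Traj X Ξ t), 0 < P.essEnvelope ν η t z
  | 0, _ => one_pos
  | t + 1, z => by
    have : Nonempty X := ⟨z.2.1⟩
    refine ENNReal.mul_pos (essEnvelope_pos η t z.1).ne' (ENNReal.mul_pos
      (ENNReal.ofReal_pos.2 (policy_pos hlik t z.1 z.2.2)).ne' fun h => ?_).ne'
    rw [ENNReal.essSup_eq_zero_iff] at h
    have : ∀ᵐ θ ∂ν, False := h.mono fun θ hθ =>
      (ENNReal.ofReal_pos.2 (Real.rpow_pos_of_pos ((hf _ _ _).1 θ) (1 - η))).ne' hθ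
    rw [eventually_false_iff_eq_bot, ae_eq_bot] at this
    exact NeZero.ne ν this

end EssEnvelope

/-! ### Bounds and convergence along a fixed trajectory -/

section FixedTrajectory

variable {P : DesignModel X Ξ Θ lam rho} {ν : Measure Θ}
  (hlik : ∀ (s : ℕ) (z : Traj X Ξ s) (zn : X × Ξ),
    (∀ θ, 0 < P.lik s z zn θ) ∧ ∃ C : ℝ, ∀ θ, P.lik s z zn θ ≤ C)
  (hf : ∀ (x : X) (ξ : Ξ) (x' : X),
    (∀ θ, 0 < P.f x ξ θ x') ∧ ∃ C : ℝ, ∀ θ, P.f x ξ θ x' ≤ C)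

variable (P) in
-- The policy does not depend on `θ` and factors out, so the density is a function of a single
-- average, that of `trans`.
theorem particleDensity_eq (η : ℝ) {M : ℕ} (t : ℕ) (z : Traj X Ξ t) (zn : X × Ξ)
    (θs : Fin M → Θ) :
    P.particleDensity η t z zn θs = P.policy t z zn.2 * (empMean θs (P.trans t z zn)
      * Real.exp (-η * Real.log (empMean θs (P.trans t z zn)))) := by
  have : empMean θs (P.lik t z zn) = empMean θs (P.trans t z zn) * P.policy t z zn.2 :=
    empMean_mul_const θs _ _
  rw [particleDensity, this]
  ring

theorem mul_exp_neg_mul_log {x : ℝ} (hx : 0 < x) (η : ℝ) :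
    x * Real.exp (-η * Real.log x) = x ^ (1 - η) := by
  rw [Real.rpow_def_of_pos hx, mul_sub, mul_one, sub_eq_add_neg, Real.exp_add, Real.exp_log hx]
  ring_nf

include hf in
theorem trans_pos (t : ℕ) (z : Traj X Ξ t) (zn : X × Ξ) (θ : Θ) : 0 < P.trans t z zn θ :=
  (hf _ _ _).1 θ

include hlik

theorem particleDensity_pos (η : ℝ) {M : ℕ} (hM : 1 ≤ M) (t : ℕ) (z : Traj X Ξ t) (zn : X × Ξ)
    (θs : Fin M → Θ) : 0 < P.particleDensity η t z zn θs :=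
  mul_pos (empMean_pos hM (hlik t z zn).1 θs) (Real.exp_pos _)

theorem targetDensity_pos (η : ℝ) : ∀ (t : ℕ) (z : Traj X Ξ t), 0 < P.targetDensity η t z
  | 0, _ => one_pos
  | t + 1, z => by
    obtain ⟨C, hC⟩ := (hlik t z.1 z.2).2
    exact mul_pos (targetDensity_pos η t z.1) (mul_pos
      (integral_posterior_pos hlik t z.1 (P.measurable_lik_right t z.1 z.2) (hlik t z.1 z.2).1 hC)
      (Real.exp_pos _))

theorem particleKernel_univ (κ : Kernel Θ Θ) [IsMarkovKernel κ] {M : ℕ} (hM : 1 ≤ M) (t : ℕ)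
    (q : (Traj X Ξ t × (X × Ξ)) × (Fin M → Θ)) : P.particleKernel κ M t q Set.univ = 1 := by
  have := isProbabilityMeasure_jitterMixture hlik κ hM t q.1.1 q.1.2 q.2
  rw [particleKernel_apply]
  exact measure_univ

/-- Resampling and jittering preserve mass; only the reweighting changes it. -/
theorem particleLaw_succ_univ (κ : Kernel Θ Θ) [IsMarkovKernel κ] (η : ℝ) {M : ℕ} (hM : 1 ≤ M)
    (t : ℕ) (z : Traj X Ξ t) (zn : X × Ξ) :
    P.particleLaw κ η M (t + 1) (z, zn) Set.univ
      = ∫⁻ θs, ENNReal.ofReal (P.particleDensity η t z zn θs) ∂(P.particleLaw κ η M t z) := by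
  have := P.lintegral_particleLaw_succ κ η M t z zn (ψ := fun _ => 1) measurable_const
  simp only [lintegral_one, particleKernel_univ hlik κ hM, mul_one] at this
  exact this

/-- Each particle of the nested filter has a law dominated by `ν`. -/
theorem map_eval_particleLaw_absolutelyContinuous (κ : Kernel Θ Θ) [IsMarkovKernel κ]
    (hν : P.prior ≪ ν) (hκν : ν.bind κ ≪ ν) (η : ℝ) {M : ℕ} (m : Fin M) :
    ∀ (t : ℕ) (z : Traj X Ξ t), (P.particleLaw κ η M t z).map (fun θs => θs m) ≪ ν := by
  have hM : 1 ≤ M := Nat.one_le_of_lt m.2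
  intro t
  induction t generalizing m with
  | zero =>
    intro z
    rw [particleLaw_zero]
    change (Measure.pi fun _ : Fin M => P.prior).map (Function.eval m) ≪ ν
    rw [(measurePreserving_eval (fun _ : Fin M => P.prior) m).map_eq]
    exact hν
  | succ t ih =>
    rintro ⟨z, zn⟩
    refine Measure.AbsolutelyContinuous.mk fun s hs h0 => ?_
    have hms : MeasurableSet ((fun θs : Fin M → Θ => θs m) ⁻¹' s) := measurable_pi_apply m hs
    rw [Measure.map_apply (measurable_pi_apply m) hs, ← lintegral_indicator_one hms]
    refine (P.lintegral_particleLaw_succ κ η M t z zn (measurable_one.indicator hms)).trans ?_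
    -- A `ν`-null set is missed by `κ θ` for `ν`-almost every `θ`, hence, by induction, at all old
    -- particles almost surely. The new particle follows a mixture of the `κ` at these points.
    have hκ0 : ∀ᵐ θ ∂ν, κ θ s = 0 := by
      have := hκν h0
      rw [Measure.bind_apply hs κ.aemeasurable,
        lintegral_eq_zero_iff (κ.measurable_coe hs)] at this
      exact this
    have hall : ∀ᵐ θs ∂(P.particleLaw κ η M t z), ∀ k, κ (θs k) s = 0 :=
      ae_all_iff.2 fun k =>
        ae_of_ae_map (measurable_pi_apply k).aemeasurable ((ih k z).ae_le hκ0)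
    rw [← lintegral_zero (μ := P.particleLaw κ η M t z)]
    refine lintegral_congr_ae ?_
    filter_upwards [hall] with θs hθs
    have := isProbabilityMeasure_jitterMixture hlik κ hM t z zn θs
    rw [lintegral_indicator_one hms, particleKernel_apply,
      ← Measure.map_apply (measurable_pi_apply m) hs]
    change _ * ((Measure.pi fun _ : Fin M => P.jitterMixture κ t z zn θs).map
      (Function.eval m)) s = 0
    rw [(measurePreserving_eval (fun _ : Fin M => P.jitterMixture κ t z zn θs) m).map_eq]
    simp [jitterMixture, hθs]

theorem ae_particleLaw (κ : Kernel Θ Θ) [IsMarkovKernel κ] (hν : P.prior ≪ ν)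
    (hκν : ν.bind κ ≪ ν) (η : ℝ) (M t : ℕ) (z : Traj X Ξ t) {p : Θ → Prop} (hp : ∀ᵐ θ ∂ν, p θ) :
    ∀ᵐ θs ∂(P.particleLaw κ η M t z), ∀ m, p (θs m) :=
  ae_all_iff.2 fun m => ae_of_ae_map (measurable_pi_apply m).aemeasurable
    ((map_eval_particleLaw_absolutelyContinuous hlik κ hν hκν η m t z).ae_le hp)

theorem particleLaw_univ_pos (κ : Kernel Θ Θ) [IsMarkovKernel κ] (η : ℝ) {M : ℕ} (hM : 1 ≤ M) :
    ∀ (t : ℕ) (z : Traj X Ξ t), 0 < P.particleLaw κ η M t z Set.univ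
  | 0, z => by rw [particleLaw_zero, measure_univ]; exact one_pos
  | t + 1, (z, zn) => by
    refine lt_of_lt_of_eq ?_ (particleLaw_succ_univ hlik κ η hM t z zn).symm
    have hm : Measurable fun θs : Fin M → Θ => ENNReal.ofReal (P.particleDensity η t z zn θs) :=
      ((P.measurable_particleDensity η M t).comp (f := fun θs : Fin M → Θ => ((z, zn), θs))
        measurable_prodMk_left).ennreal_ofReal
    rw [lintegral_pos_iff_support hm]
    have : Function.support
        (fun θs : Fin M → Θ => ENNReal.ofReal (P.particleDensity η t z zn θs)) = Set.univ :=
      Set.eq_univ_of_forall fun θs =>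
        (ENNReal.ofReal_pos.2 (particleDensity_pos hlik η hM t z zn θs)).ne'
    rw [this]
    exact particleLaw_univ_pos κ η hM t z

include hf

/-- The density is the policy times the power `1 - η` of an average, which is at most that power at
some particle; almost surely every particle obeys the essential bound. No case distinction between
`η ≤ 1` and `η > 1` is left to make here. -/
theorem ae_particleDensity_le (κ : Kernel Θ Θ) [IsMarkovKernel κ] (hν : P.prior ≪ ν)
    (hκν : ν.bind κ ≪ ν) (η : ℝ) {M : ℕ} (hM : 1 ≤ M) (t : ℕ) (z : Traj X Ξ t) (zn : X × Ξ) :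
    ∀ᵐ θs ∂(P.particleLaw κ η M t z), ENNReal.ofReal (P.particleDensity η t z zn θs)
      ≤ ENNReal.ofReal (P.policy t z zn.2)
        * essSup (fun θ => ENNReal.ofReal (P.trans t z zn θ ^ (1 - η))) ν := by
  filter_upwards [ae_particleLaw hlik κ hν hκν η M t z
    (ENNReal.ae_le_essSup fun θ => ENNReal.ofReal (P.trans t z zn θ ^ (1 - η)))] with θs hθs
  have hpos := trans_pos hf t z zn
  rw [particleDensity_eq, mul_exp_neg_mul_log (empMean_pos hM hpos θs),
    ENNReal.ofReal_mul (P.policy_nonneg _ _ _)]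
  obtain ⟨m, hm⟩ := exists_empMean_rpow_le hM hpos (1 - η) θs
  exact mul_le_mul' le_rfl ((ENNReal.ofReal_le_ofReal hm).trans (hθs m))

/-- The one-step bound iterated. The right-hand side does not depend on `M`, as domination requires.
-/
theorem particleLaw_univ_le (κ : Kernel Θ Θ) [IsMarkovKernel κ] (hν : P.prior ≪ ν)
    (hκν : ν.bind κ ≪ ν) (η : ℝ) {M : ℕ} (hM : 1 ≤ M) :
    ∀ (t : ℕ) (z : Traj X Ξ t), P.particleLaw κ η M t z Set.univ ≤ P.essEnvelope ν η t z
  | 0, z => by rw [particleLaw_zero, measure_univ]; exact le_rfl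
  | t + 1, (z, zn) => by
    refine (particleLaw_succ_univ hlik κ η hM t z zn).trans_le ?_
    refine (lintegral_mono_ae (ae_particleDensity_le hlik hf κ hν hκν η hM t z zn)).trans ?_
    rw [lintegral_const, mul_comm]
    exact mul_le_mul' (particleLaw_univ_le κ hν hκν η hM t z) le_rfl

/-- For a fixed trajectory, the mass of `particleLaw` converges to the target density, and the
particle averages converge in mean to the posterior averages. -/
theorem tendsto_particleLaw (κ : ℕ → Kernel Θ Θ) [∀ M, IsMarkovKernel (κ M)]
    (hκ : IsJittering κ) (hν : P.prior ≪ ν) (hκν : ∀ M, ν.bind (κ M) ≪ ν) [NeZero ν] (η : ℝ) :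
    ∀ (t : ℕ) (z : Traj X Ξ t), P.essEnvelope ν η t z ≠ ⊤ →
      Tendsto (fun M => P.particleLaw (κ M) η M t z Set.univ) atTop
        (𝓝 (ENNReal.ofReal (P.targetDensity η t z))) ∧
      ∀ (h : Θ → ℝ), Measurable h → (∃ b, ∀ θ, |h θ| ≤ b) →
        Tendsto (fun M => ∫⁻ θs, ENNReal.ofReal |empMean θs h - ∫ θ, h θ ∂(P.posterior t z)|
          ∂(P.particleLaw (κ M) η M t z)) atTop (𝓝 0) := by
  have hsqrt : ∀ b : ℝ, Tendsto (fun M : ℕ => ENNReal.ofReal (b / Real.sqrt M)) atTop (𝓝 0) := by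
    intro b
    rw [← ENNReal.ofReal_zero]
    exact ENNReal.tendsto_ofReal (tendsto_const_nhds.div_atTop
      (Real.tendsto_sqrt_atTop.comp tendsto_natCast_atTop_atTop))
  intro t
  induction t with
  | zero =>
    intro z _
    refine ⟨?_, fun h hh ⟨b, hb⟩ => ?_⟩
    · simp only [particleLaw_zero, measure_univ, targetDensity, ENNReal.ofReal_one]
      exact tendsto_const_nhds
    · have hpost : ∫ θ, h θ ∂(P.posterior 0 z) = ∫ θ, h θ ∂P.prior := by
        rw [integral_posterior hlik]
        simp [fullLik]
      simp only [particleLaw_zero, hpost]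
      refine tendsto_of_tendsto_of_tendsto_of_le_of_le' tendsto_const_nhds (hsqrt b)
        (Eventually.of_forall fun _ => zero_le) ?_
      filter_upwards [eventually_ge_atTop 1] with M hM
      exact lintegral_abs_empMean_sub_le P.prior hM hh hb
  | succ t ih =>
    rintro ⟨z, zn⟩ hz
    have : Nonempty X := ⟨zn.1⟩
    set B : ENNReal := ENNReal.ofReal (P.policy t z zn.2)
      * essSup (fun θ => ENNReal.ofReal (P.trans t z zn θ ^ (1 - η))) ν
    have hB0 : P.essEnvelope ν η (t + 1) (z, zn) = P.essEnvelope ν η t z * B := rfl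
    have hzB : P.essEnvelope ν η t z * B < ⊤ := by rw [← hB0]; exact hz.lt_top
    -- Finiteness of the product `essEnvelope * B` gives finiteness of each factor only because
    -- neither vanishes.
    have hBpos : B ≠ 0 := fun h => by
      have := essEnvelope_pos (ν := ν) hlik hf η (t + 1) (z, zn)
      rw [hB0, h, mul_zero] at this
      exact lt_irrefl _ this
    have hBtop : B ≠ ⊤ := (ENNReal.lt_top_of_mul_ne_top_right hzB.ne
      (essEnvelope_pos hlik hf η t z).ne').ne
    have hztop : P.essEnvelope ν η t z ≠ ⊤ := (ENNReal.lt_top_of_mul_ne_top_left hzB.ne hBpos).ne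
    obtain ⟨hmass, hmean⟩ := ih z hztop
    have hlm := P.measurable_lik_right t z zn
    have htm := P.measurable_trans_right t z zn
    obtain ⟨Cl, hCl⟩ := (hlik t z zn).2
    obtain ⟨Ct, hCt⟩ : ∃ C : ℝ, ∀ θ, P.trans t z zn θ ≤ C := (hf _ _ _).2
    have hl0 : ∀ θ, |P.lik t z zn θ| ≤ Cl := fun θ => by
      rw [abs_of_pos ((hlik t z zn).1 θ)]; exact hCl θ
    have htpos := trans_pos hf t z zn
    set aT := ∫ θ, P.trans t z zn θ ∂(P.posterior t z)
    set a := ∫ θ, P.lik t z zn θ ∂(P.posterior t z)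
    have hT : 0 < aT := integral_posterior_pos hlik t z htm htpos hCt
    have ha : 0 < a := integral_posterior_pos hlik t z hlm (hlik t z zn).1 hCl
    have haT : a = aT * P.policy t z zn.2 := integral_mul_const _ _
    refine ⟨?_, fun h hh ⟨b, hb⟩ => ?_⟩
    -- As a function `g` may be unbounded; the bound `B` holds only along the particle averages.
    -- Continuity is needed only at the positive value `aT`, away from the singularity of the
    -- logarithm.
    · let g : ℝ → ℝ := fun x => P.policy t z zn.2 * (x * Real.exp (-η * Real.log x))
      have hg : Measurable g := by fun_prop
      have hgc : ContinuousAt g aT := by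
        have := (Real.continuousAt_log hT.ne')
        fun_prop
      have hlim := tendsto_lintegral_comp_of_tendsto_mean (l := atTop)
        (fun M => P.particleLaw (κ M) η M t z)
        (fun M (θs : Fin M → Θ) => empMean θs (P.trans t z zn)) (fun M => measurable_empMean htm)
        ENNReal.ofReal_ne_top hmass
        (hmean _ htm ⟨Ct, fun θ => by rw [abs_of_pos (htpos θ)]; exact hCt θ⟩) hg hgc
        (K := B.toReal) (by
          filter_upwards [eventually_ge_atTop 1] with M hM
          filter_upwards [ae_particleDensity_le hlik hf (κ M) hν (hκν M) η hM t z zn] with θs hθs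
          have h1 : g (empMean θs (P.trans t z zn)) = P.particleDensity η t z zn θs :=
            (P.particleDensity_eq η t z zn θs).symm
          rw [h1, abs_of_pos (particleDensity_pos hlik η hM t z zn θs)]
          exact (ENNReal.ofReal_le_iff_le_toReal hBtop).1 hθs)
      have hval : ENNReal.ofReal (g aT) * ENNReal.ofReal (P.targetDensity η t z)
          = ENNReal.ofReal (P.targetDensity η (t + 1) (z, zn)) := by
        rw [mul_comm, ← ENNReal.ofReal_mul (targetDensity_pos hlik η t z).le]
        change _ = ENNReal.ofReal (P.targetDensity η t z
          * (a * Real.exp (η * -Real.log aT)))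
        congr 2
        rw [haT]
        simp only [g]
        rw [show η * -Real.log aT = -η * Real.log aT by ring]
        ring
      rw [← hval]
      refine hlim.congr' ?_
      filter_upwards [eventually_ge_atTop 1] with M hM
      refine Eq.trans (lintegral_congr fun θs => ?_)
        (particleLaw_succ_univ hlik (κ M) η hM t z zn).symm
      rw [particleDensity_eq]
    · obtain ⟨c, hc⟩ := hκ
      have hb0 : 0 ≤ b := by
        obtain ⟨θ⟩ : Nonempty Θ := nonempty_of_isProbabilityMeasure P.prior
        exact (abs_nonneg _).trans (hb θ)
      set n := ∫ θ, P.lik t z zn θ * h θ ∂(P.posterior t z)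
      have hpost : ∫ θ, h θ ∂(P.posterior (t + 1) (z, zn)) = n / a :=
        integral_posterior_succ hlik t z zn h
      -- The claim for `h` at time `t + 1` calls on that for `lik * h` and `lik` at time `t`, hence
      -- the quantification over all bounded functions. Both are bounded because the trajectory is
      -- fixed.
      have hnum := hmean (fun θ => P.lik t z zn θ * h θ) (hlm.mul hh) ⟨Cl * b, fun θ => by
        rw [abs_mul]
        exact mul_le_mul (hl0 θ) (hb θ) (abs_nonneg _) ((abs_nonneg _).trans (hl0 θ))⟩
      have hden := hmean _ hlm ⟨Cl, hl0⟩
      -- `B` bounds the reweighting factor, and the mass multiplies the constant error terms because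
      -- `particleLaw` is not normalized.
      have hlim : Tendsto (fun M : ℕ => B * ((ENNReal.ofReal (b / Real.sqrt M)
            + ENNReal.ofReal (c * b / Real.sqrt M)) * P.particleLaw (κ M) η M t z Set.univ
          + ENNReal.ofReal a⁻¹ * (∫⁻ θs, ENNReal.ofReal
              |empMean θs (fun θ => P.lik t z zn θ * h θ) - n| ∂(P.particleLaw (κ M) η M t z)
            + ENNReal.ofReal b * ∫⁻ θs, ENNReal.ofReal |empMean θs (P.lik t z zn) - a|
              ∂(P.particleLaw (κ M) η M t z)))) atTop
          (𝓝 (B * ((0 + 0) * ENNReal.ofReal (P.targetDensity η t z)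
            + ENNReal.ofReal a⁻¹ * (0 + ENNReal.ofReal b * 0)))) := by
        refine ENNReal.Tendsto.const_mul (Tendsto.add ?_ ?_) (Or.inr hBtop)
        · exact ENNReal.Tendsto.mul ((hsqrt b).add (hsqrt (c * b))) (Or.inr ENNReal.ofReal_ne_top)
            hmass (Or.inr (by simp))
        · exact ENNReal.Tendsto.const_mul (hnum.add (ENNReal.Tendsto.const_mul hden
            (Or.inr ENNReal.ofReal_ne_top))) (Or.inr ENNReal.ofReal_ne_top)
      simp only [mul_zero, zero_mul, add_zero] at hlim
      refine tendsto_of_tendsto_of_tendsto_of_le_of_le' tendsto_const_nhds hlim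
        (Eventually.of_forall fun _ => zero_le) ?_
      filter_upwards [eventually_ge_atTop 1] with M hM
      have hψ : Measurable fun θs : Fin M → Θ => ENNReal.ofReal |empMean θs h - n / a| :=
        ((measurable_empMean hh).sub_const _).abs.ennreal_ofReal
      have hm1 : Measurable fun θs : Fin M → Θ => ENNReal.ofReal
          |empMean θs (fun θ => P.lik t z zn θ * h θ) - n| :=
        ((measurable_empMean (hlm.mul hh)).sub_const _).abs.ennreal_ofReal
      have hm2 : Measurable fun θs : Fin M → Θ => ENNReal.ofReal
          |empMean θs (P.lik t z zn) - a| :=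
        ((measurable_empMean hlm).sub_const _).abs.ennreal_ofReal
      rw [hpost]
      refine (P.lintegral_particleLaw_succ (κ M) η M t z zn hψ).trans_le ?_
      calc _ ≤ ∫⁻ θs, B * ((ENNReal.ofReal (b / Real.sqrt M)
              + ENNReal.ofReal (c * b / Real.sqrt M))
            + ENNReal.ofReal a⁻¹ * (ENNReal.ofReal
                |empMean θs (fun θ => P.lik t z zn θ * h θ) - n|
              + ENNReal.ofReal b * ENNReal.ofReal |empMean θs (P.lik t z zn) - a|))
              ∂(P.particleLaw (κ M) η M t z) := by
            refine lintegral_mono_ae ?_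
            filter_upwards [ae_particleDensity_le hlik hf (κ M) hν (hκν M) η hM t z zn] with θs hθs
            exact mul_le_mul' hθs (lintegral_abs_sub_particleKernel_le hlik (κ M) hM t z zn θs hh
              hb0 hb (hc M hM h b hh hb) ha)
        _ = _ := by
            rw [lintegral_const_mul _ (by fun_prop), lintegral_add_left measurable_const,
              lintegral_const, lintegral_const_mul _ (by fun_prop), lintegral_add_left hm1,
              lintegral_const_mul _ hm2]

end FixedTrajectory

/-! ### Integration over trajectories and normalization -/

section Consistency

/-- Normalization of a finite nonzero measure. -/
theorem _root_.MeasureTheory.isProbabilityMeasure_inv_smul {α : Type*} [MeasurableSpace α]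
    {μ : Measure α} (h0 : μ Set.univ ≠ 0) (ht : μ Set.univ ≠ ⊤) :
    IsProbabilityMeasure ((μ Set.univ)⁻¹ • μ) :=
  ⟨by rw [Measure.smul_apply, smul_eq_mul, ENNReal.inv_mul_cancel h0 ht]⟩

/-- Densities that converge almost everywhere and are dominated by an integrable function define
measures whose integrals of bounded functions converge. -/
theorem tendsto_integral_withDensity_of_dominated {α : Type*} [MeasurableSpace α] {μ : Measure α}
    {G : ℕ → α → ENNReal} {G' E : α → ENNReal} (hG : ∀ n, Measurable (G n))
    (hG' : AEMeasurable G' μ) (hE : Measurable E) (hEfin : ∫⁻ x, E x ∂μ ≠ ⊤)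
    (hle : ∀ᶠ n in atTop, ∀ x, G n x ≤ E x) (hlt : ∀ᵐ x ∂μ, G' x < ⊤)
    (hlim : ∀ᵐ x ∂μ, Tendsto (fun n => G n x) atTop (𝓝 (G' x)))
    {h : α → ℝ} (hh : Measurable h) {b : ℝ} (hb : ∀ x, |h x| ≤ b) :
    Tendsto (fun n => ∫ x, h x ∂(μ.withDensity (G n))) atTop
      (𝓝 (∫ x, h x ∂(μ.withDensity G'))) := by
  have hElt : ∀ᵐ x ∂μ, E x < ⊤ := ae_lt_top hE hEfin
  rw [integral_withDensity_eq_integral_toReal_smul₀ hG' hlt]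
  have h1 : Tendsto (fun n => ∫ x, (G n x).toReal • h x ∂μ) atTop
      (𝓝 (∫ x, (G' x).toReal • h x ∂μ)) := by
    refine tendsto_integral_filter_of_dominated_convergence (fun x => (E x).toReal * b) ?_ ?_ ?_ ?_
    · exact Eventually.of_forall fun n =>
        ((hG n).ennreal_toReal.smul hh).aestronglyMeasurable
    · filter_upwards [hle] with n hn
      filter_upwards [hElt] with x hx
      rw [norm_smul, Real.norm_of_nonneg ENNReal.toReal_nonneg]
      exact mul_le_mul (ENNReal.toReal_mono hx.ne (hn x)) (hb x) (norm_nonneg _)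
        ENNReal.toReal_nonneg
    · exact (integrable_toReal_of_lintegral_ne_top hE.aemeasurable hEfin).mul_const b
    · filter_upwards [hlim, hlt] with x hx hx'
      exact ((ENNReal.tendsto_toReal hx'.ne).comp hx).smul_const (h x)
  refine h1.congr' ?_
  filter_upwards [hle] with n hn
  rw [integral_withDensity_eq_integral_toReal_smul (hG n)
    (hElt.mono fun x hx => (hn x).trans_lt hx)]

variable [SigmaFinite lam] [SigmaFinite rho]

theorem prod_ne_zero {α β : Type*} [MeasurableSpace α] [MeasurableSpace β] {μ : Measure α}
    {ν : Measure β} [SFinite ν] (hμ : μ ≠ 0) (hν : ν ≠ 0) : μ.prod ν ≠ 0 := by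
  rw [← Measure.measure_univ_ne_zero, ← Set.univ_prod_univ, Measure.prod_prod]
  exact mul_ne_zero (Measure.measure_univ_ne_zero.2 hμ) (Measure.measure_univ_ne_zero.2 hν)

/-- Transition and policy densities integrate to one, so neither `lam` nor `rho` can vanish. With
everywhere positive densities this makes the normalizing constants positive. -/
theorem ref_ne_zero (P : DesignModel X Ξ Θ lam rho) : ∀ t, P.ref t ≠ 0
  | 0 => IsProbabilityMeasure.ne_zero P.init
  | t + 1 => by
    obtain ⟨x⟩ : Nonempty X := nonempty_of_isProbabilityMeasure P.init
    obtain ⟨θ⟩ : Nonempty Θ := nonempty_of_isProbabilityMeasure P.prior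
    have hrho : rho ≠ 0 := fun h =>
      zero_ne_one (((congrArg (fun m => ∫⁻ ξ, ENNReal.ofReal (P.policy 0 x ξ) ∂m) h).trans
        (lintegral_zero_measure _)).symm.trans (P.policy_lintegral 0 x))
    -- A design is needed to evaluate the transition density; one exists because `rho` is nonzero.
    obtain ⟨ξ⟩ : Nonempty Ξ := by
      by_contra hempty
      rw [not_nonempty_iff] at hempty
      exact hrho (Measure.eq_zero_of_isEmpty rho)
    have hlam : lam ≠ 0 := fun h =>
      zero_ne_one (((congrArg (fun m => ∫⁻ x', ENNReal.ofReal (P.f x ξ θ x') ∂m) h).trans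
        (lintegral_zero_measure _)).symm.trans (P.f_lintegral x ξ θ))
    exact prod_ne_zero (ref_ne_zero P t) (prod_ne_zero hlam hrho)

theorem withDensity_univ_ne_zero {α : Type*} [MeasurableSpace α] {μ : Measure α} (hμ : μ ≠ 0)
    {G : α → ENNReal} (hG : AEMeasurable G μ) (hpos : ∀ x, 0 < G x) :
    μ.withDensity G Set.univ ≠ 0 := by
  rw [Measure.measure_univ_ne_zero, Ne, withDensity_eq_zero_iff hG]
  intro h
  have : ∀ᵐ x ∂μ, False := h.mono fun x hx => (hpos x).ne' hx
  rw [eventually_false_iff_eq_bot, ae_eq_bot] at this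
  exact hμ this

/-- Consistency of the nested filter over a general parameter space. -/
theorem isProbabilityMeasure_and_tendsto_nestedMarginal (P : DesignModel X Ξ Θ lam rho)
    (κ : ℕ → Kernel Θ Θ) [∀ M, IsMarkovKernel (κ M)] (hκ : IsJittering κ) (η : ℝ)
    (hlik : ∀ (s : ℕ) (z : Traj X Ξ s) (zn : X × Ξ),
      (∀ θ, 0 < P.lik s z zn θ) ∧ ∃ C : ℝ, ∀ θ, P.lik s z zn θ ≤ C)
    (hf : ∀ (x : X) (ξ : Ξ) (x' : X),
      (∀ θ, 0 < P.f x ξ θ x') ∧ ∃ C : ℝ, ∀ θ, P.f x ξ θ x' ≤ C)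
    (t : ℕ) (hint : ∫⁻ z, P.envelope η t z ∂(P.ref t) < ⊤) :
    IsProbabilityMeasure (P.target η t) ∧
    (∀ M : ℕ, 1 ≤ M → IsProbabilityMeasure (P.nestedMarginal (κ M) η M t)) ∧
    ∀ h : Traj X Ξ t → ℝ, Measurable h → (∃ b : ℝ, ∀ z, |h z| ≤ b) →
      Tendsto (fun M : ℕ => ∫ z, h z ∂(P.nestedMarginal (κ M) η M t)) atTop
        (𝓝 (∫ z, h z ∂(P.target η t))) := by
  obtain ⟨ν, hνs, hν, hκν⟩ := exists_sFinite_absolutelyContinuous_bind κ P.prior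
  have hν0 : NeZero ν := ⟨fun h => IsProbabilityMeasure.ne_zero P.prior
    (Measure.absolutelyContinuous_zero_iff.1 (h ▸ hν))⟩
  let E := P.essEnvelope ν η t
  have hE : Measurable E := P.measurable_essEnvelope ν η t
  have hEfin : ∫⁻ z, E z ∂(P.ref t) ≠ ⊤ :=
    ((lintegral_mono (P.essEnvelope_le_envelope ν η t)).trans_lt hint).ne
  let G : ℕ → Traj X Ξ t → ENNReal := fun M z => P.particleLaw (κ M) η M t z Set.univ
  let G' : Traj X Ξ t → ENNReal := fun z => ENNReal.ofReal (P.targetDensity η t z)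
  have hG : ∀ M, Measurable (G M) := fun M =>
    (P.particleLaw (κ M) η M t).measurable_coe MeasurableSet.univ
  have hle : ∀ M, 1 ≤ M → ∀ z, G M z ≤ E z := fun M hM z =>
    particleLaw_univ_le hlik hf (κ M) hν (hκν M) η hM t z
  have hlim : ∀ᵐ z ∂(P.ref t), Tendsto (fun M => G M z) atTop (𝓝 (G' z)) := by
    filter_upwards [ae_lt_top hE hEfin] with z hz
    exact (tendsto_particleLaw hlik hf κ hκ hν hκν η t z hz.ne).1
  -- Measurability of the target density is inherited from the masses, as their almost everywhere
  -- limit, which avoids joint measurability of posterior integrals.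
  have hG' : AEMeasurable G' (P.ref t) :=
    aemeasurable_of_tendsto_metrizable_ae atTop (fun M => (hG M).aemeasurable) hlim
  have hconv : ∀ {h : Traj X Ξ t → ℝ}, Measurable h → ∀ {b : ℝ}, (∀ z, |h z| ≤ b) →
      Tendsto (fun M => ∫ z, h z ∂((P.ref t).withDensity (G M))) atTop
        (𝓝 (∫ z, h z ∂((P.ref t).withDensity G'))) := fun hh _ hb =>
    tendsto_integral_withDensity_of_dominated hG hG' hE hEfin
      (eventually_atTop.2 ⟨1, hle⟩) (ae_of_all _ fun _ => ENNReal.ofReal_lt_top) hlim hh hb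
  have hGfin : ∀ M, 1 ≤ M → (P.ref t).withDensity (G M) Set.univ ≠ ⊤ := fun M hM => by
    rw [withDensity_apply _ MeasurableSet.univ, setLIntegral_univ]
    exact ((lintegral_mono (hle M hM)).trans_lt hEfin.lt_top).ne
  have hG'fin : (P.ref t).withDensity G' Set.univ ≠ ⊤ := by
    rw [withDensity_apply _ MeasurableSet.univ, setLIntegral_univ]
    refine ((lintegral_mono_ae ?_).trans_lt hEfin.lt_top).ne
    filter_upwards [hlim] with z hz
    exact le_of_tendsto hz (eventually_atTop.2 ⟨1, fun M hM => hle M hM z⟩)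
  have hG0 : ∀ M, 1 ≤ M → (P.ref t).withDensity (G M) Set.univ ≠ 0 := fun M hM =>
    withDensity_univ_ne_zero (P.ref_ne_zero t) (hG M).aemeasurable fun z =>
      particleLaw_univ_pos hlik (κ M) η hM t z
  have hG'0 : (P.ref t).withDensity G' Set.univ ≠ 0 :=
    withDensity_univ_ne_zero (P.ref_ne_zero t) hG' fun z =>
      ENNReal.ofReal_pos.2 (targetDensity_pos hlik η t z)
  have hmarg : ∀ M, P.nestedMarginal (κ M) η M t
      = ((P.ref t).withDensity (G M) Set.univ)⁻¹ • (P.ref t).withDensity (G M) := fun M => by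
    -- Pushing forward preserves total mass, so normalizing on paths or on trajectories is the same.
    have hm := P.map_traj_nestedUnnorm (κ M) η M t
    rw [nestedMarginal, nestedTarget, Measure.map_smul, hm, ← hm,
      Measure.map_apply (NPath.measurable_traj t) MeasurableSet.univ, Set.preimage_univ, hm]
  refine ⟨isProbabilityMeasure_inv_smul hG'0 hG'fin, fun M hM => ?_, fun h hh ⟨b, hb⟩ => ?_⟩
  · rw [hmarg]
    exact isProbabilityMeasure_inv_smul (hG0 M hM) (hGfin M hM)
  -- The normalizing constants are the case of the constant function `1`.
  · have hone : Tendsto (fun M => ((P.ref t).withDensity (G M) Set.univ).toReal) atTop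
        (𝓝 ((P.ref t).withDensity G' Set.univ).toReal) := by
      have := hconv (h := fun _ => 1) measurable_const (b := 1) (fun _ => by simp)
      simpa [Measure.real] using this
    have hnum := hconv hh hb
    simp only [hmarg, target, targetUnnorm, integral_smul_measure, ENNReal.toReal_inv]
    exact (hone.inv₀ (ENNReal.toReal_ne_zero.2 ⟨hG'0, hG'fin⟩)).smul hnum

end Consistency

end DesignModel

end

theorem proposition1 {X Ξ : Type u} [MeasurableSpace X] [MeasurableSpace Ξ]
    (lam : Measure X) [SigmaFinite lam] (rho : Measure Ξ) [SigmaFinite rho]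
    {d : ℕ} (D : Set (EuclideanSpace ℝ (Fin d))) (hD : IsCompact D)
    (P : DesignModel X Ξ D lam rho)
    (κ : ℕ → Kernel D D) [∀ M, IsMarkovKernel (κ M)] (hκ : IsJittering κ)
    (η : ℝ) (hη : 0 < η)
    (hlik : ∀ (s : ℕ) (z : Traj X Ξ s) (zn : X × Ξ),
      (∀ θ, 0 < P.lik s z zn θ) ∧ ∃ C : ℝ, ∀ θ, P.lik s z zn θ ≤ C)
    (hf : ∀ (x : X) (ξ : Ξ) (x' : X),
      (∀ θ, 0 < P.f x ξ θ x') ∧ ∃ C : ℝ, ∀ θ, P.f x ξ θ x' ≤ C)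
    (t : ℕ) (hint : ∫⁻ z, P.envelope η t z ∂(P.ref t) < ⊤) :
    IsProbabilityMeasure (P.target η t) ∧
    (∀ M : ℕ, 1 ≤ M → IsProbabilityMeasure (P.nestedMarginal (κ M) η M t)) ∧
    ∀ h : Traj X Ξ t → ℝ, Measurable h → (∃ b : ℝ, ∀ z, |h z| ≤ b) →
      Tendsto (fun M : ℕ => ∫ z, h z ∂(P.nestedMarginal (κ M) η M t)) atTop
        (𝓝 (∫ z, h z ∂(P.target η t))) :=
  P.isProbabilityMeasure_and_tendsto_nestedMarginal κ hκ η hlik hf t hint
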